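/- For a commutative ring $A$ let $P_n(A)$ be the $A$-module of homogeneous polynomials of degree $n$ in two variables over $A$, on which $\begin{pmatrix} \alpha & \beta\\ \gamma & \delta\end{pmatrix}\in SL_2(A)$ acts by $f(X,Y)\mapsto f(\alpha X+\gamma Y,\beta X+\delta Y)$. Let $(P_1\boxtimes P_3)(A)=P_1(A)\otimes_A P_3(A)$, with the action of $SL_2(A)\times SL_2(A)$ in which the first factor acts on $P_1$ (variables $Z,W$) and the second on $P_3$ (variables $X,Y$). Write an element as $$F=(aZ+bW)\otimes X^3+(cZ+dW)\otimes X^2Y+(eZ+fW)\otimes XY^2+(gZ+hW)\otimes Y^3 .$$ Let $\mathrm{disc}_{X,Y}F$ be the discriminant of $F$ as a binary cubic form in $X,Y$ over $A[Z,W]$ (the discriminant of $pX^3+qX^2Y+rXY^2+sY^3$ being $q^2r^2-4pr^3-4q^3s+18pqrs-27p^2s^2$), which is a binary quartic form in $Z,W$, and let $\mathrm{disc}_{Z,W}$ be the usual discriminant of binary quartic forms (the one with $\mathrm{disc}_{Z,W}(\alpha Z^4+\varepsilon W^4)=256\,\alpha^3\varepsilon^3$). Define polynomials over $\mathbb{Z}$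 in $a,\dots,h$ by $$\begin{aligned}H_6={}&-d^3 e^3 + 3 c d^2 e^2 f - 3 c^2 d e f^2 + c^3 f^3 + 9 b d^2 e^2 g + 9 b c d e f g - 27 a d^2 e f g - 27 b^2 e^2 f g - 18 b c^2 f^2 g + 27 a c d f^2 g + 54 a b e f^2 g - 27 a^2 f^3 g - 27 b c d^2 g^2 + 27 a d^3 g^2 + 81 b^2 c f g^2 - 81 a b d f g^2 - 27 b c d e^2 h + 18 a d^2 e^2 h + 27 b^2 e^3 h + 27 b c^2 e f h - 9 a c d e f h - 54 a b e^2 f h - 9 a c^2 f^2 h + 27 a^2 e f^2 h + 54 b c^2 d g h - 54 a c d^2 g h - 81 b^2 c e g h + 81 a b d e g h - 81 a b c f g h + 81 a^2 d f g h - 27 b c^3 h^2 + 27 a c^2 d h^2 + 81 a b c e h^2 - 81 a^2 d e h^2\end{aligned}$$ and $$\begin{aligned}G_6={}&b c d e f g - a d^2 e f g - b^2 e^2 f g - b c^2 f^2 g + a c d f^2 g + 2 a b e f^2 g - a^2 f^3 g - b c d^2 g^2 + a d^3 g^2 + b^2 d e g^2 + 2 b^2 c f g^2 - 3 a b d f g^2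 - b^3 g^3 - b c d e^2 h + a d^2 e^2 h + b^2 e^3 h + b c^2 e f h - a c d e f h - 2 a b e^2 f h + a^2 e f^2 h + 2 b c^2 d g h - 2 a c d^2 g h - 3 b^2 c e g h + a b d e g h - a b c f g h + 3 a^2 d f g h + 3 a b^2 g^2 h - b c^3 h^2 + a c^2 d h^2 + 3 a b c e h^2 - 2 a^2 d e h^2 - a^2 c f h^2 - 3 a^2 b g h^2 + a^3 h^3,\end{aligned}$$ and set $\Delta=H_6^3G_6\in\mathbb{Z}[a,b,c,d,e,f,g,h]$. **Proposition 5.2.** (i) For every commutative ring $A$ and every $F\in(P_1\boxtimes P_3)(A)$ one has $\mathrm{disc}_{Z,W}(\mathrm{disc}_{X,Y}F)=-2^8\,\Delta(F)$. (ii) Let $p$ be any prime and let $\bar\Delta$ be the reduction of $\Delta$ mod $p$. A vector $F\in(P_1\boxtimes P_3)(\overline{\mathbb{F}}_p)$ is stable for the action of $SL_2(\overline{\mathbb{F}}_p)\times SL_2(\overline{\mathbb{F}}_p)$ (that is, its orbit is Zariski closed and its stabilizer is finite) if and only if $\bar\Delta(F)\neq0$. -/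

import Mathlib

open MvPolynomial TensorProduct

noncomputable section

/-! ## Stable vectors -/

section Stability

variable (E : Type*) [Field E] (V : Type*) [AddCommGroup V] [Module E V]

/-- The algebra of polynomial functions on a vector space: the algebra of functions generated by
the linear forms (and the constants). -/
def polynomialFunctionAlgebra : Subalgebra E (V → E) :=
  Algebra.adjoin E (Set.range fun l : Module.Dual E V => (l : V → E))

variable {V}

/-- A subset of a vector space is Zariski closed if it is the common zero locus of a set of
polynomial functions. -/
def IsZariskiClosed (S : Set V) : Prop :=
  ∃ T : Set (V → E), T ⊆ polynomialFunctionAlgebra E V ∧ S = {v | ∀ f ∈ T, f v = 0}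

variable {E}

/-- A vector is stable if its orbit is Zariski closed and its stabilizer is finite. Here `G` is the
group of points over the algebraically closed field `E`. -/
def IsStableVector {G : Type*} [Group G] (ρ : Representation E G V) (v : V) : Prop :=
  IsZariskiClosed E (Set.range fun g : G => ρ g v) ∧ {g : G | ρ g v = v}.Finite

end Stability

/-! ## The representation of `SL₂ × SL₂` on `P₁ ⊠ P₃` -/

section Rep

variable {A : Type*} [CommRing A]

/-- The substitution `f(X, Y) ↦ f(aX + cY, bX + dY)` for `g = (a b; c d)`, where `X`, `Y` are the
variables with index `0`, `1`. -/
def substTranspose (g : Matrix.SpecialLinearGroup (Fin 2) A) :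
    MvPolynomial (Fin 2) A →ₐ[A] MvPolynomial (Fin 2) A :=
  aeval fun j => C (g.1 0 j) * X 0 + C (g.1 1 j) * X 1

theorem substTranspose_one : substTranspose (1 : Matrix.SpecialLinearGroup (Fin 2) A) =
    AlgHom.id A _ := by
  apply MvPolynomial.algHom_ext
  intro j
  fin_cases j <;> simp [substTranspose]

theorem substTranspose_mul (g h : Matrix.SpecialLinearGroup (Fin 2) A) :
    substTranspose (g * h) = (substTranspose g).comp (substTranspose h) := by
  apply MvPolynomial.algHom_ext
  intro j
  simp only [substTranspose, aeval_X, AlgHom.comp_apply, map_add, map_mul, algHom_C,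
    MvPolynomial.algebraMap_eq, Matrix.SpecialLinearGroup.coe_mul, Matrix.mul_apply,
    Fin.sum_univ_two]
  ring

theorem substTranspose_mem (g : Matrix.SpecialLinearGroup (Fin 2) A) (n : ℕ)
    (f : MvPolynomial (Fin 2) A) (hf : f ∈ homogeneousSubmodule (Fin 2) A n) :
    substTranspose g f ∈ homogeneousSubmodule (Fin 2) A n := by
  rw [mem_homogeneousSubmodule] at hf ⊢
  have h : (substTranspose g f).IsHomogeneous (1 * n) := IsHomogeneous.aeval hf
    (fun j => C (g.1 0 j) * X 0 + C (g.1 1 j) * X 1)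
    (fun j => (isHomogeneous_C_mul_X _ _).add (isHomogeneous_C_mul_X _ _))
  rwa [one_mul] at h

variable (A)

/-- `P_n(A)`: binary forms of degree `n` over `A`. -/
abbrev BinaryForm (n : ℕ) : Type _ := homogeneousSubmodule (Fin 2) A n

/-- The natural action of `SL₂(A)` on `P_n(A)`, by precomposition by the transpose. -/
def binaryFormRep (n : ℕ) :
    Representation A (Matrix.SpecialLinearGroup (Fin 2) A) (BinaryForm A n) where
  toFun g := (substTranspose g).toLinearMap.restrict (substTranspose_mem g n)
  map_one' := by
    ext f
    simp [substTranspose_one]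
  map_mul' g h := by
    refine LinearMap.ext fun f => Subtype.ext ?_
    exact congrArg (fun φ => φ (f : MvPolynomial (Fin 2) A)) (substTranspose_mul g h)

/-- `(P₁ ⊠ P₃)(A)`. The variables of `P₁` are called `Z`, `W`, those of `P₃` are called `X`, `Y`
(in both cases with indices `0`, `1`). -/
abbrev P1P3 : Type _ := BinaryForm A 1 ⊗[A] BinaryForm A 3

/-- The action of `SL₂(A) × SL₂(A)` on `(P₁ ⊠ P₃)(A)`: the first factor acts on `P₁`, the second
one on `P₃`. -/
def P1P3.rep : Representation A
    (Matrix.SpecialLinearGroup (Fin 2) A × Matrix.SpecialLinearGroup (Fin 2) A) (P1P3 A) :=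
  Representation.tprod ((binaryFormRep A 1).comp (MonoidHom.fst _ _))
    ((binaryFormRep A 3).comp (MonoidHom.snd _ _))

variable {A}

/-- The coefficient of `u^i v^j` in a binary form of degree `n` in the variables `u`, `v`. -/
def BinaryForm.coeffHom (n i j : ℕ) : BinaryForm A n →ₗ[A] A :=
  lcoeff A (Finsupp.single 0 i + Finsupp.single 1 j) ∘ₗ Submodule.subtype _

/-- The coefficient of `Z^i W^j ⊗ X^k Y^l` in an element of `P₁ ⊠ P₃`. -/
def P1P3.coeffHom (i j k l : ℕ) : P1P3 A →ₗ[A] A :=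
  LinearMap.mul' A A ∘ₗ TensorProduct.map (BinaryForm.coeffHom 1 i j) (BinaryForm.coeffHom 3 k l)

/-- The coefficients `a, b, c, d, e, f, g, h` of
`F = (aZ + bW) ⊗ X³ + (cZ + dW) ⊗ X²Y + (eZ + fW) ⊗ XY² + (gZ + hW) ⊗ Y³`. -/
def P1P3.coords (F : P1P3 A) : Fin 8 → A :=
  ![P1P3.coeffHom 1 0 3 0 F, P1P3.coeffHom 0 1 3 0 F,
    P1P3.coeffHom 1 0 2 1 F, P1P3.coeffHom 0 1 2 1 F,
    P1P3.coeffHom 1 0 1 2 F, P1P3.coeffHom 0 1 1 2 F,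
    P1P3.coeffHom 1 0 0 3 F, P1P3.coeffHom 0 1 0 3 F]

/-! ## Discriminants -/

/-- The discriminant of the binary cubic form `p X³ + q X²Y + r XY² + s Y³`. -/
def cubicFormDisc {R : Type*} [CommRing R] (p q r s : R) : R :=
  q ^ 2 * r ^ 2 - 4 * p * r ^ 3 - 4 * q ^ 3 * s + 18 * p * q * r * s - 27 * p ^ 2 * s ^ 2

/-- The discriminant of the binary quartic form
`α Z⁴ + β Z³W + γ Z²W² + δ ZW³ + ε W⁴`. -/
def quarticFormDisc {R : Type*} [CommRing R] (α β γ δ ε : R) : R :=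
  256 * α ^ 3 * ε ^ 3 - 192 * α ^ 2 * β * δ * ε ^ 2 - 128 * α ^ 2 * γ ^ 2 * ε ^ 2
    + 144 * α ^ 2 * γ * δ ^ 2 * ε - 27 * α ^ 2 * δ ^ 4 + 144 * α * β ^ 2 * γ * ε ^ 2
    - 6 * α * β ^ 2 * δ ^ 2 * ε - 80 * α * β * γ ^ 2 * δ * ε + 18 * α * β * γ * δ ^ 3
    + 16 * α * γ ^ 4 * ε - 4 * α * γ ^ 3 * δ ^ 2 - 27 * β ^ 4 * ε ^ 2
    + 18 * β ^ 3 * γ * δ * ε - 4 * β ^ 3 * δ ^ 3 - 4 * β ^ 2 * γ ^ 3 * ε + β ^ 2 * γ ^ 2 * δ ^ 2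

/-- `disc_{X,Y} F`: the discriminant of `F`, regarded as a cubic form in `X`, `Y` whose
coefficients are linear forms in `Z`, `W`. It is a quartic form in `Z = X 0`, `W = X 1`. -/
def P1P3.discXY (F : P1P3 A) : MvPolynomial (Fin 2) A :=
  let v := P1P3.coords F
  cubicFormDisc (C (v 0) * X 0 + C (v 1) * X 1) (C (v 2) * X 0 + C (v 3) * X 1)
    (C (v 4) * X 0 + C (v 5) * X 1) (C (v 6) * X 0 + C (v 7) * X 1)

/-- `disc_{Z,W} Q` of a quartic form `Q` in `Z = X 0`, `W = X 1`. -/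
def discZW (Q : MvPolynomial (Fin 2) A) : A :=
  let co (i j : ℕ) : A := coeff (Finsupp.single 0 i + Finsupp.single 1 j) Q
  quarticFormDisc (co 4 0) (co 3 1) (co 2 2) (co 1 3) (co 0 4)

end Rep

/-! ## The polynomial `Δ` -/

/-- The formula for `H₆`. -/
def H6Formula {R : Type*} [CommRing R] (a b c d e f g h : R) : R :=
  -d^3 * e^3 + 3 * c * d^2 * e^2 * f - 3 * c^2 * d * e * f^2 + c^3 * f^3 + 9 * b * d^2 * e^2 * g
    + 9 * b * c * d * e * f * g - 27 * a * d^2 * e * f * g - 27 * b^2 * e^2 * f * g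
    - 18 * b * c^2 * f^2 * g + 27 * a * c * d * f^2 * g + 54 * a * b * e * f^2 * g
    - 27 * a^2 * f^3 * g - 27 * b * c * d^2 * g^2 + 27 * a * d^3 * g^2 + 81 * b^2 * c * f * g^2
    - 81 * a * b * d * f * g^2 - 27 * b * c * d * e^2 * h + 18 * a * d^2 * e^2 * h
    + 27 * b^2 * e^3 * h + 27 * b * c^2 * e * f * h - 9 * a * c * d * e * f * h
    - 54 * a * b * e^2 * f * h - 9 * a * c^2 * f^2 * h + 27 * a^2 * e * f^2 * h
    + 54 * b * c^2 * d * g * h - 54 * a * c * d^2 * g * h - 81 * b^2 * c * e * g * h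
    + 81 * a * b * d * e * g * h - 81 * a * b * c * f * g * h + 81 * a^2 * d * f * g * h
    - 27 * b * c^3 * h^2 + 27 * a * c^2 * d * h^2 + 81 * a * b * c * e * h^2
    - 81 * a^2 * d * e * h^2

/-- The formula for `G₆`. -/
def G6Formula {R : Type*} [CommRing R] (a b c d e f g h : R) : R :=
  b * c * d * e * f * g - a * d^2 * e * f * g - b^2 * e^2 * f * g - b * c^2 * f^2 * g
    + a * c * d * f^2 * g + 2 * a * b * e * f^2 * g - a^2 * f^3 * g - b * c * d^2 * g^2
    + a * d^3 * g^2 + b^2 * d * e * g^2 + 2 * b^2 * c * f * g^2 - 3 * a * b * d * f * g^2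
    - b^3 * g^3 - b * c * d * e^2 * h + a * d^2 * e^2 * h + b^2 * e^3 * h + b * c^2 * e * f * h
    - a * c * d * e * f * h - 2 * a * b * e^2 * f * h + a^2 * e * f^2 * h
    + 2 * b * c^2 * d * g * h - 2 * a * c * d^2 * g * h - 3 * b^2 * c * e * g * h
    + a * b * d * e * g * h - a * b * c * f * g * h + 3 * a^2 * d * f * g * h
    + 3 * a * b^2 * g^2 * h - b * c^3 * h^2 + a * c^2 * d * h^2 + 3 * a * b * c * e * h^2
    - 2 * a^2 * d * e * h^2 - a^2 * c * f * h^2 - 3 * a^2 * b * g * h^2 + a^3 * h^3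

/-- `H₆` as a polynomial over `ℤ` in the variables `a, b, c, d, e, f, g, h = X 0, …, X 7`. -/
def H6 : MvPolynomial (Fin 8) ℤ :=
  H6Formula (X 0) (X 1) (X 2) (X 3) (X 4) (X 5) (X 6) (X 7)

/-- `G₆` as a polynomial over `ℤ` in the variables `a, b, c, d, e, f, g, h = X 0, …, X 7`. -/
def G6 : MvPolynomial (Fin 8) ℤ :=
  G6Formula (X 0) (X 1) (X 2) (X 3) (X 4) (X 5) (X 6) (X 7)

/-- `Δ = H₆³ G₆`, a polynomial over `ℤ` in eight variables. -/
def Delta : MvPolynomial (Fin 8) ℤ := H6 ^ 3 * G6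

/-- The reduction of `Δ` mod `p`, as a polynomial over an algebraic closure of `𝔽_p`. -/
def DeltaBar (p : ℕ) [Fact p.Prime] : MvPolynomial (Fin 8) (AlgebraicClosure (ZMod p)) :=
  map (Int.castRingHom (AlgebraicClosure (ZMod p))) Delta

end

/-!
The representation is studied through the pencil of binary cubic forms
`z p₁ + w p₂`, where `p₁ = aX³ + cX²Y + eXY² + gY³` and `p₂ = bX³ + dX²Y + fXY² + hY³`. The first
factor `SL₂` changes the basis `p₁, p₂`, and the second one changes the variables `X, Y`. Besides
`G₆`, which is the resultant of `p₁` and `p₂`, there is an invariant `A₂` of degree `2`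
(`A2Formula`), and `27 G₆ = A₂³ + H₆`.

For the discriminant identity, the two basic invariants of the quartic form `disc_{X,Y} F`, of
degrees `2` and `3` in its coefficients, are polynomials in `A₂` and `G₆`
(`quarticInvariant₂_disc`, `quarticInvariant₃_disc`). The discriminant of a quartic form is
`(4I³ - J²) / 27` in terms of these, so the identity holds over `ℤ[a, …, h]`, and hence over every
commutative ring.

Stability is decided over any algebraically closed field, of any characteristic
(`P1P3.isStableVector_iff`).

* If `G₆ = 0`, then `p₁` and `p₂` have a common zero. If `H₆ = 0`, then the pencil contains the cube
  of a linear form up to a scalar; this is where characteristic `3` has to be treated apart. In both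
  cases the element can be moved to a position in which it has a limit under a one-parameter
  subgroup (`P1P3.not_stable_of_base_point`, `P1P3.not_stable_of_cube`). The limit has an infinite
  stabilizer, so it does not lie in the orbit of an element with a finite one
  (`not_isStableVector_of_limit`).
* If `G₆` and `H₆` do not vanish, then some member of the pencil has a double zero that is not a
  triple zero, because `disc_{X,Y} F` has a zero. Moving its zeros to `X = 0` and `Y = 0` leads to
  the normal form `Z ⊗ X²Y + W ⊗ (-G₆ X³ - A₂ XY² + Y³)` (`P1P3.exists_rep_eq_normalForm`). So the
  orbit is the set on which `A₂` and `G₆` take given values, which is Zariski closed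
  (`P1P3.orbit_eq`), and the stabilizer of the normal form is computed to be finite
  (`P1P3.finite_stabilizer_normalForm`).
-/

noncomputable section

/-! ### The discriminant identity -/

/-- The invariant of degree `2` of `SL₂ × SL₂` on `P₁ ⊠ P₃`. -/
def A2Formula {R : Type*} [CommRing R] (a b c d e f g h : R) : R :=
  d * e - c * f + 3 * (a * h - b * g)

/-- The coefficient of `Z³W` in `disc_{X,Y} F`. Exchanging `Z` and `W` gives that of `ZW³`. -/
def discCoeff₃₁ {R : Type*} [CommRing R] (a b c d e f g h : R) : R :=
  2 * c * d * e ^ 2 + 2 * c ^ 2 * e * f - 4 * (b * e ^ 3 + 3 * a * e ^ 2 * f)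
    - 4 * (c ^ 3 * h + 3 * c ^ 2 * d * g)
    + 18 * (b * c * e * g + a * d * e * g + a * c * f * g + a * c * e * h)
    - 27 * (2 * a * b * g ^ 2 + 2 * a ^ 2 * g * h)

/-- The coefficient of `Z²W²` in `disc_{X,Y} F`. -/
def discCoeff₂₂ {R : Type*} [CommRing R] (a b c d e f g h : R) : R :=
  d ^ 2 * e ^ 2 + 4 * c * d * e * f + c ^ 2 * f ^ 2 - 4 * (3 * b * e ^ 2 * f + 3 * a * e * f ^ 2)
    - 4 * (3 * c ^ 2 * d * h + 3 * c * d ^ 2 * g)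
    + 18 * (a * c * f * h + a * d * e * h + a * d * f * g + b * c * e * h + b * c * f * g
      + b * d * e * g)
    - 27 * (b ^ 2 * g ^ 2 + 4 * a * b * g * h + a ^ 2 * h ^ 2)

section DiscriminantIdentity

variable {R : Type*} [CommRing R] (a b c d e f g h : R)

theorem twentySeven_mul_G6Formula :
    27 * G6Formula a b c d e f g h = A2Formula a b c d e f g h ^ 3 + H6Formula a b c d e f g h := by
  simp only [A2Formula, G6Formula, H6Formula]
  ring

theorem cubicFormDisc_pencil (z w : R) :
    cubicFormDisc (a * z + b * w) (c * z + d * w) (e * z + f * w) (g * z + h * w) =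
      cubicFormDisc a c e g * (z ^ 4 * w ^ 0) + discCoeff₃₁ a b c d e f g h * (z ^ 3 * w ^ 1)
        + discCoeff₂₂ a b c d e f g h * (z ^ 2 * w ^ 2)
        + discCoeff₃₁ b a d c f e h g * (z ^ 1 * w ^ 3) + cubicFormDisc b d f h * (z ^ 0 * w ^ 4) := by
  simp only [discCoeff₃₁, discCoeff₂₂, cubicFormDisc]
  ring

theorem twentySeven_mul_quarticFormDisc (α β γ δ ε : R) :
    27 * quarticFormDisc α β γ δ ε = 4 * (12 * α * ε - 3 * β * δ + γ ^ 2) ^ 3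
      - (72 * α * γ * ε + 9 * β * γ * δ - 27 * α * δ ^ 2 - 27 * ε * β ^ 2 - 2 * γ ^ 3) ^ 2 := by
  simp only [quarticFormDisc]
  ring

/-- The invariant of degree `2` of the quartic form `disc_{X,Y} F`. -/
theorem quarticInvariant₂_disc :
    12 * cubicFormDisc a c e g * cubicFormDisc b d f h
        - 3 * discCoeff₃₁ a b c d e f g h * discCoeff₃₁ b a d c f e h g
        + discCoeff₂₂ a b c d e f g h ^ 2 =
      A2Formula a b c d e f g h
        * (A2Formula a b c d e f g h ^ 3 + 216 * G6Formula a b c d e f g h) := by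
  simp only [discCoeff₃₁, discCoeff₂₂, cubicFormDisc, A2Formula, G6Formula]
  ring

set_option maxHeartbeats 0 in
set_option maxRecDepth 100000 in
/-- The invariant of degree `3` of the quartic form `disc_{X,Y} F`. -/
theorem quarticInvariant₃_disc :
    72 * cubicFormDisc a c e g * discCoeff₂₂ a b c d e f g h * cubicFormDisc b d f h
        + 9 * discCoeff₃₁ a b c d e f g h * discCoeff₂₂ a b c d e f g h
          * discCoeff₃₁ b a d c f e h g
        - 27 * cubicFormDisc a c e g * discCoeff₃₁ b a d c f e h g ^ 2
        - 27 * cubicFormDisc b d f h * discCoeff₃₁ a b c d e f g h ^ 2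
        - 2 * discCoeff₂₂ a b c d e f g h ^ 3 =
      -2 * (A2Formula a b c d e f g h ^ 6
        - 540 * A2Formula a b c d e f g h ^ 3 * G6Formula a b c d e f g h
        - 5832 * G6Formula a b c d e f g h ^ 2) := by
  simp only [discCoeff₃₁, discCoeff₂₂, cubicFormDisc, A2Formula, G6Formula]
  ring

theorem quarticFormDisc_disc_of_charZero [IsDomain R] [CharZero R] :
    quarticFormDisc (cubicFormDisc a c e g) (discCoeff₃₁ a b c d e f g h)
        (discCoeff₂₂ a b c d e f g h) (discCoeff₃₁ b a d c f e h g) (cubicFormDisc b d f h) =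
      -(2 ^ 8) * (H6Formula a b c d e f g h ^ 3 * G6Formula a b c d e f g h) := by
  have h27 : (27 : R) ≠ 0 := by norm_num
  apply mul_left_cancel₀ h27
  rw [twentySeven_mul_quarticFormDisc, quarticInvariant₂_disc, quarticInvariant₃_disc,
    eq_sub_of_add_eq' (twentySeven_mul_G6Formula a b c d e f g h).symm]
  ring

/-- The polynomial identity behind `disc_{Z,W} (disc_{X,Y} F) = -2⁸ Δ(F)`, valid over every
commutative ring because it is the image of the identity over `ℤ[a, …, h]`. -/
theorem quarticFormDisc_disc :
    quarticFormDisc (cubicFormDisc a c e g) (discCoeff₃₁ a b c d e f g h)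
        (discCoeff₂₂ a b c d e f g h) (discCoeff₃₁ b a d c f e h g) (cubicFormDisc b d f h) =
      -(2 ^ 8) * (H6Formula a b c d e f g h ^ 3 * G6Formula a b c d e f g h) := by
  have key := congrArg (aeval ![a, b, c, d, e, f, g, h]) (quarticFormDisc_disc_of_charZero
    (X 0 : MvPolynomial (Fin 8) ℤ) (X 1) (X 2) (X 3) (X 4) (X 5) (X 6) (X 7))
  simpa [quarticFormDisc, cubicFormDisc, discCoeff₃₁, discCoeff₂₂, H6Formula, G6Formula] using key

theorem aeval_Delta (v : Fin 8 → R) : aeval v Delta =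
    H6Formula (v 0) (v 1) (v 2) (v 3) (v 4) (v 5) (v 6) (v 7) ^ 3
      * G6Formula (v 0) (v 1) (v 2) (v 3) (v 4) (v 5) (v 6) (v 7) := by
  simp [Delta, H6, G6, H6Formula, G6Formula]

theorem coeff_C_mul_X_pow_mul_X_pow (r : R) (i j k l : ℕ) :
    coeff (Finsupp.single 0 i + Finsupp.single 1 j)
      (C r * (X 0 ^ k * X 1 ^ l) : MvPolynomial (Fin 2) R) = if k = i ∧ l = j then r else 0 := by
  have hinj : (Finsupp.single 0 k + Finsupp.single 1 l : Fin 2 →₀ ℕ) =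
      Finsupp.single 0 i + Finsupp.single 1 j ↔ k = i ∧ l = j := by
    constructor
    · intro H
      have h0 := DFunLike.congr_fun H 0
      have h1 := DFunLike.congr_fun H 1
      simp at h0 h1
      exact ⟨h0, h1⟩
    · rintro ⟨rfl, rfl⟩
      rfl
  rw [X_pow_eq_monomial, X_pow_eq_monomial, monomial_mul, coeff_C_mul, coeff_monomial]
  simp [hinj]

end DiscriminantIdentity

theorem P1P3.discXY_eq {A : Type*} [CommRing A] (F : P1P3 A) (a b c d e f g h : A)
    (hF : P1P3.coords F = ![a, b, c, d, e, f, g, h]) : P1P3.discXY F =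
      C (cubicFormDisc a c e g) * (X 0 ^ 4 * X 1 ^ 0)
        + C (discCoeff₃₁ a b c d e f g h) * (X 0 ^ 3 * X 1 ^ 1)
        + C (discCoeff₂₂ a b c d e f g h) * (X 0 ^ 2 * X 1 ^ 2)
        + C (discCoeff₃₁ b a d c f e h g) * (X 0 ^ 1 * X 1 ^ 3)
        + C (cubicFormDisc b d f h) * (X 0 ^ 0 * X 1 ^ 4) := by
  have key := cubicFormDisc_pencil (C a : MvPolynomial (Fin 2) A) (C b) (C c) (C d) (C e) (C f)
    (C g) (C h) (X 0) (X 1)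
  have e₁ : P1P3.discXY F = cubicFormDisc (C a * X 0 + C b * X 1) (C c * X 0 + C d * X 1)
      (C e * X 0 + C f * X 1) (C g * X 0 + C h * X 1) := by
    simp only [P1P3.discXY, hF]
    rfl
  rw [e₁, key]
  simp [cubicFormDisc, discCoeff₃₁, discCoeff₂₂,
    map_ofNat (C : A →+* MvPolynomial (Fin 2) A)]

theorem P1P3.coords_eta {A : Type*} [CommRing A] (F : P1P3 A) :
    P1P3.coords F = ![P1P3.coords F 0, P1P3.coords F 1, P1P3.coords F 2, P1P3.coords F 3,
      P1P3.coords F 4, P1P3.coords F 5, P1P3.coords F 6, P1P3.coords F 7] := by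
  ext i
  fin_cases i <;> rfl

theorem P1P3.discZW_discXY {A : Type*} [CommRing A] (F : P1P3 A) :
    discZW (P1P3.discXY F) = -(2 ^ 8) * aeval (P1P3.coords F) Delta := by
  rw [P1P3.discXY_eq F _ _ _ _ _ _ _ _ F.coords_eta, aeval_Delta, ← quarticFormDisc_disc]
  simp only [discZW, coeff_add, coeff_C_mul_X_pow_mul_X_pow]
  norm_num

/-! ### Coordinates on `P₁ ⊠ P₃` -/

section Coordinates

variable {A : Type*} [CommRing A]

theorem BinaryForm.coe_eq_sum {n : ℕ} (f : BinaryForm A n) : (f : MvPolynomial (Fin 2) A) =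
    ∑ k ∈ Finset.range (n + 1), C (BinaryForm.coeffHom n k (n - k) f) * (X 0 ^ k * X 1 ^ (n - k)) := by
  ext m
  have hm : m = Finsupp.single 0 (m 0) + Finsupp.single 1 (m 1) := by
    ext i
    fin_cases i <;> simp
  have hdeg : m.degree = m 0 + m 1 := by
    simp [Finsupp.degree_eq_sum]
  have hf : (f : MvPolynomial (Fin 2) A).IsHomogeneous n := (mem_homogeneousSubmodule _ _).1 f.2
  rw [coeff_sum]
  by_cases h : m 0 + m 1 = n
  · rw [Finset.sum_eq_single (m 0)]
    · rw [hm, coeff_C_mul_X_pow_mul_X_pow]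
      have : n - m 0 = m 1 := by omega
      simp [this, BinaryForm.coeffHom, ← hm]
    · intro k _ hk
      rw [hm, coeff_C_mul_X_pow_mul_X_pow]
      simp [hk]
    · intro hk
      exact absurd (Finset.mem_range.2 (by omega)) hk
  · rw [hf.coeff_eq_zero (by rwa [hdeg]), Finset.sum_eq_zero]
    intro k hk
    have := Finset.mem_range.1 hk
    rw [hm, coeff_C_mul_X_pow_mul_X_pow, if_neg (by omega)]

variable (A) in
/-- The monomial `u^i v^j` as a binary form of degree `n = i + j`. -/
def BinaryForm.mono (n i j : ℕ) (h : i + j = n) : BinaryForm A n :=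
  ⟨X 0 ^ i * X 1 ^ j, (mem_homogeneousSubmodule _ _).2 (h ▸ (isHomogeneous_X_pow _ _).mul
    (isHomogeneous_X_pow _ _))⟩

@[simp]
theorem BinaryForm.coeffHom_mono (n i j k l : ℕ) (h : k + l = n) :
    BinaryForm.coeffHom n i j (BinaryForm.mono A n k l h) = if k = i ∧ l = j then 1 else 0 := by
  simpa [BinaryForm.coeffHom, BinaryForm.mono] using coeff_C_mul_X_pow_mul_X_pow (1 : A) i j k l

theorem BinaryForm.linear_eq (l : BinaryForm A 1) :
    l = BinaryForm.coeffHom 1 1 0 l • BinaryForm.mono A 1 1 0 rfl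
      + BinaryForm.coeffHom 1 0 1 l • BinaryForm.mono A 1 0 1 rfl := by
  apply Subtype.ext
  conv_lhs => rw [BinaryForm.coe_eq_sum l]
  simp [Finset.sum_range_succ, BinaryForm.mono, smul_eq_C_mul]
  ring

theorem BinaryForm.cubic_eq (q : BinaryForm A 3) :
    q = BinaryForm.coeffHom 3 3 0 q • BinaryForm.mono A 3 3 0 rfl
      + BinaryForm.coeffHom 3 2 1 q • BinaryForm.mono A 3 2 1 rfl
      + BinaryForm.coeffHom 3 1 2 q • BinaryForm.mono A 3 1 2 rfl
      + BinaryForm.coeffHom 3 0 3 q • BinaryForm.mono A 3 0 3 rfl := by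
  apply Subtype.ext
  conv_lhs => rw [BinaryForm.coe_eq_sum q]
  simp [Finset.sum_range_succ, BinaryForm.mono, smul_eq_C_mul]
  ring

@[simp]
theorem P1P3.coeffHom_tmul (i j k l : ℕ) (u : BinaryForm A 1) (q : BinaryForm A 3) :
    P1P3.coeffHom i j k l (u ⊗ₜ[A] q) =
      BinaryForm.coeffHom 1 i j u * BinaryForm.coeffHom 3 k l q := by
  simp [P1P3.coeffHom]

/-- The monomials `Z ⊗ X³, W ⊗ X³, …, Z ⊗ Y³, W ⊗ Y³`, in the order of the coefficients
`a, …, h`. -/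
def P1P3.monomials : Fin 8 → P1P3 A :=
  let z := BinaryForm.mono A 1 1 0 rfl
  let w := BinaryForm.mono A 1 0 1 rfl
  ![z ⊗ₜ BinaryForm.mono A 3 3 0 rfl, w ⊗ₜ BinaryForm.mono A 3 3 0 rfl,
    z ⊗ₜ BinaryForm.mono A 3 2 1 rfl, w ⊗ₜ BinaryForm.mono A 3 2 1 rfl,
    z ⊗ₜ BinaryForm.mono A 3 1 2 rfl, w ⊗ₜ BinaryForm.mono A 3 1 2 rfl,
    z ⊗ₜ BinaryForm.mono A 3 0 3 rfl, w ⊗ₜ BinaryForm.mono A 3 0 3 rfl]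

variable (A) in
/-- `a, …, h` are linear coordinates on `P₁ ⊠ P₃`. -/
def P1P3.coordsEquiv : P1P3 A ≃ₗ[A] (Fin 8 → A) where
  toFun := P1P3.coords
  map_add' F G := by
    ext i
    fin_cases i <;> simp [P1P3.coords]
  map_smul' r F := by
    ext i
    fin_cases i <;> simp [P1P3.coords]
  invFun v := ∑ i, v i • P1P3.monomials i
  left_inv F := by
    refine TensorProduct.induction_on F ?_ (fun u q => ?_) (fun F G hF hG => ?_)
    · simp [P1P3.coords, Fin.sum_univ_eight]
    · conv_rhs => rw [BinaryForm.linear_eq u, BinaryForm.cubic_eq q]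
      simp only [Fin.sum_univ_eight, P1P3.monomials, P1P3.coords, P1P3.coeffHom_tmul, add_tmul,
        tmul_add, smul_tmul_smul]
      simp
      abel
    · conv_rhs => rw [← hF, ← hG]
      rw [← Finset.sum_add_distrib]
      refine Finset.sum_congr rfl fun i _ => ?_
      rw [← add_smul]
      congr 1
      fin_cases i <;> simp [P1P3.coords]
  right_inv v := by
    ext i
    fin_cases i <;> simp [P1P3.coords, Fin.sum_univ_eight, P1P3.monomials]

/-- The element of `P₁ ⊠ P₃` with coefficients `a, …, h`. -/
def P1P3.mk (a b c d e f g h : A) : P1P3 A :=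
  (P1P3.coordsEquiv A).symm ![a, b, c, d, e, f, g, h]

@[simp]
theorem P1P3.coords_mk (a b c d e f g h : A) :
    P1P3.coords (P1P3.mk a b c d e f g h) = ![a, b, c, d, e, f, g, h] :=
  (P1P3.coordsEquiv A).apply_symm_apply _

theorem P1P3.coords_injective : Function.Injective (P1P3.coords (A := A)) :=
  (P1P3.coordsEquiv A).injective

theorem P1P3.exists_eq_mk (F : P1P3 A) : ∃ a b c d e f g h, F = P1P3.mk a b c d e f g h :=
  ⟨_, _, _, _, _, _, _, _, P1P3.coords_injective (by rw [P1P3.coords_mk, ← P1P3.coords_eta])⟩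

theorem P1P3.mk_inj {a b c d e f g h a' b' c' d' e' f' g' h' : A} :
    P1P3.mk a b c d e f g h = P1P3.mk a' b' c' d' e' f' g' h' ↔
      a = a' ∧ b = b' ∧ c = c' ∧ d = d' ∧ e = e' ∧ f = f' ∧ g = g' ∧ h = h' := by
  constructor
  · intro H
    have := congrArg P1P3.coords H
    rw [P1P3.coords_mk, P1P3.coords_mk] at this
    exact ⟨congr_fun this 0, congr_fun this 1, congr_fun this 2, congr_fun this 3,
      congr_fun this 4, congr_fun this 5, congr_fun this 6, congr_fun this 7⟩
  · rintro ⟨rfl, rfl, rfl, rfl, rfl, rfl, rfl, rfl⟩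
    rfl

/-! ### The action in coordinates -/

/-- The cubic form `p(αX+γY)³ + q(αX+γY)²(βX+δY) + r(αX+γY)(βX+δY)² + s(βX+δY)³`, as the vector of
its four coefficients. -/
def cubicSubst (α β γ δ p q r s : A) : Fin 4 → A :=
  ![p * α ^ 3 + q * α ^ 2 * β + r * α * β ^ 2 + s * β ^ 3,
    3 * p * α ^ 2 * γ + q * (α ^ 2 * δ + 2 * α * β * γ) + r * (γ * β ^ 2 + 2 * α * β * δ)
      + 3 * s * β ^ 2 * δ,
    3 * p * α * γ ^ 2 + q * (γ ^ 2 * β + 2 * α * γ * δ) + r * (α * δ ^ 2 + 2 * β * γ * δ)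
      + 3 * s * β * δ ^ 2,
    p * γ ^ 3 + q * γ ^ 2 * δ + r * γ * δ ^ 2 + s * δ ^ 3]

theorem substTranspose_cubic (g : Matrix.SpecialLinearGroup (Fin 2) A) (p q r s : A) :
    let v := cubicSubst (g.1 0 0) (g.1 0 1) (g.1 1 0) (g.1 1 1) p q r s
    substTranspose g (C p * (X 0 ^ 3 * X 1 ^ 0) + C q * (X 0 ^ 2 * X 1 ^ 1)
        + C r * (X 0 ^ 1 * X 1 ^ 2) + C s * (X 0 ^ 0 * X 1 ^ 3)) =
      C (v 0) * (X 0 ^ 3 * X 1 ^ 0) + C (v 1) * (X 0 ^ 2 * X 1 ^ 1)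
        + C (v 2) * (X 0 ^ 1 * X 1 ^ 2) + C (v 3) * (X 0 ^ 0 * X 1 ^ 3) := by
  simp [substTranspose, cubicSubst, map_ofNat (C : A →+* MvPolynomial (Fin 2) A),
    MvPolynomial.algebraMap_eq]
  ring

theorem BinaryForm.coeffHom_rep_cubic (g : Matrix.SpecialLinearGroup (Fin 2) A)
    (f : BinaryForm A 3) (i : Fin 4) :
    BinaryForm.coeffHom 3 (3 - i) i (binaryFormRep A 3 g f) =
      cubicSubst (g.1 0 0) (g.1 0 1) (g.1 1 0) (g.1 1 1) (BinaryForm.coeffHom 3 3 0 f)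
        (BinaryForm.coeffHom 3 2 1 f) (BinaryForm.coeffHom 3 1 2 f)
        (BinaryForm.coeffHom 3 0 3 f) i := by
  have h : ((binaryFormRep A 3 g f : BinaryForm A 3) : MvPolynomial (Fin 2) A) =
      substTranspose g f := rfl
  have hf : (f : MvPolynomial (Fin 2) A) = _ := BinaryForm.coe_eq_sum f
  rw [Finset.sum_range_succ', Finset.sum_range_succ', Finset.sum_range_succ',
    Finset.sum_range_one, add_right_comm] at hf
  have key := substTranspose_cubic g (BinaryForm.coeffHom 3 3 0 f)
    (BinaryForm.coeffHom 3 2 1 f) (BinaryForm.coeffHom 3 1 2 f) (BinaryForm.coeffHom 3 0 3 f)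
  have hf' : (f : MvPolynomial (Fin 2) A) = C (BinaryForm.coeffHom 3 3 0 f) * (X 0 ^ 3 * X 1 ^ 0)
      + C (BinaryForm.coeffHom 3 2 1 f) * (X 0 ^ 2 * X 1 ^ 1)
      + C (BinaryForm.coeffHom 3 1 2 f) * (X 0 ^ 1 * X 1 ^ 2)
      + C (BinaryForm.coeffHom 3 0 3 f) * (X 0 ^ 0 * X 1 ^ 3) := by
    rw [hf]
    simp
    ring
  rw [← hf', ← h] at key
  simp only [BinaryForm.coeffHom, LinearMap.comp_apply, Submodule.subtype_apply, lcoeff_apply] at key ⊢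
  rw [key]
  simp only [coeff_add, coeff_C_mul_X_pow_mul_X_pow]
  fin_cases i <;> simp

theorem BinaryForm.coeffHom_rep_linear (g : Matrix.SpecialLinearGroup (Fin 2) A)
    (l : BinaryForm A 1) :
    BinaryForm.coeffHom 1 1 0 (binaryFormRep A 1 g l) =
        g.1 0 0 * BinaryForm.coeffHom 1 1 0 l + g.1 0 1 * BinaryForm.coeffHom 1 0 1 l ∧
      BinaryForm.coeffHom 1 0 1 (binaryFormRep A 1 g l) =
        g.1 1 0 * BinaryForm.coeffHom 1 1 0 l + g.1 1 1 * BinaryForm.coeffHom 1 0 1 l := by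
  have h : ((binaryFormRep A 1 g l : BinaryForm A 1) : MvPolynomial (Fin 2) A) =
      substTranspose g l := rfl
  set x := BinaryForm.coeffHom 1 1 0 l with hx
  set y := BinaryForm.coeffHom 1 0 1 l with hy
  have key : ((binaryFormRep A 1 g l : BinaryForm A 1) : MvPolynomial (Fin 2) A) =
      C (g.1 0 0 * x + g.1 0 1 * y) * (X 0 ^ 1 * X 1 ^ 0)
        + C (g.1 1 0 * x + g.1 1 1 * y) * (X 0 ^ 0 * X 1 ^ 1) := by
    rw [h, BinaryForm.coe_eq_sum l]
    simp [Finset.sum_range_succ, substTranspose, ← hx, ← hy, MvPolynomial.algebraMap_eq]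
    ring
  simp only [BinaryForm.coeffHom, LinearMap.comp_apply, Submodule.subtype_apply, lcoeff_apply]
  rw [key]
  simp only [coeff_add, coeff_C_mul_X_pow_mul_X_pow]
  simp

theorem P1P3.rep_tmul (g : Matrix.SpecialLinearGroup (Fin 2) A × Matrix.SpecialLinearGroup (Fin 2) A)
    (l : BinaryForm A 1) (q : BinaryForm A 3) :
    P1P3.rep A g (l ⊗ₜ q) = binaryFormRep A 1 g.1 l ⊗ₜ binaryFormRep A 3 g.2 q := by
  simp [P1P3.rep]

/-- The action of `SL₂ × SL₂` on the coefficients `a, …, h`: the second factor acts on the two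
cubic forms of the pencil, and the first one takes linear combinations of the results. -/
theorem P1P3.rep_mk (g : Matrix.SpecialLinearGroup (Fin 2) A × Matrix.SpecialLinearGroup (Fin 2) A)
    (a b c d e f g' h : A) :
    let u := cubicSubst (g.2.1 0 0) (g.2.1 0 1) (g.2.1 1 0) (g.2.1 1 1) a c e g'
    let v := cubicSubst (g.2.1 0 0) (g.2.1 0 1) (g.2.1 1 0) (g.2.1 1 1) b d f h
    P1P3.rep A g (P1P3.mk a b c d e f g' h) =
      P1P3.mk (g.1.1 0 0 * u 0 + g.1.1 0 1 * v 0) (g.1.1 1 0 * u 0 + g.1.1 1 1 * v 0)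
        (g.1.1 0 0 * u 1 + g.1.1 0 1 * v 1) (g.1.1 1 0 * u 1 + g.1.1 1 1 * v 1)
        (g.1.1 0 0 * u 2 + g.1.1 0 1 * v 2) (g.1.1 1 0 * u 2 + g.1.1 1 1 * v 2)
        (g.1.1 0 0 * u 3 + g.1.1 0 1 * v 3) (g.1.1 1 0 * u 3 + g.1.1 1 1 * v 3) := by
  intro u v
  let z := BinaryForm.mono A 1 1 0 rfl
  let w := BinaryForm.mono A 1 0 1 rfl
  let form (p q r s : A) : BinaryForm A 3 := p • BinaryForm.mono A 3 3 0 rfl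
    + q • BinaryForm.mono A 3 2 1 rfl + r • BinaryForm.mono A 3 1 2 rfl
    + s • BinaryForm.mono A 3 0 3 rfl
  have hmk : P1P3.mk a b c d e f g' h = z ⊗ₜ form a c e g' + w ⊗ₜ form b d f h := by
    apply P1P3.coords_injective
    rw [P1P3.coords_mk]
    ext i
    fin_cases i <;> simp [P1P3.coords, z, w, form]
  have hform (p q r s : A) (i : Fin 4) :
      BinaryForm.coeffHom 3 (3 - i) i (binaryFormRep A 3 g.2 (form p q r s)) =
        cubicSubst (g.2.1 0 0) (g.2.1 0 1) (g.2.1 1 0) (g.2.1 1 1) p q r s i := by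
    rw [BinaryForm.coeffHom_rep_cubic]
    simp [form]
  have h0 (p q r s : A) : BinaryForm.coeffHom 3 3 0 (binaryFormRep A 3 g.2 (form p q r s)) = _ :=
    hform p q r s 0
  have h1 (p q r s : A) : BinaryForm.coeffHom 3 2 1 (binaryFormRep A 3 g.2 (form p q r s)) = _ :=
    hform p q r s 1
  have h2 (p q r s : A) : BinaryForm.coeffHom 3 1 2 (binaryFormRep A 3 g.2 (form p q r s)) = _ :=
    hform p q r s 2
  have h3 (p q r s : A) : BinaryForm.coeffHom 3 0 3 (binaryFormRep A 3 g.2 (form p q r s)) = _ :=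
    hform p q r s 3
  have hz := BinaryForm.coeffHom_rep_linear g.1 z
  have hw := BinaryForm.coeffHom_rep_linear g.1 w
  simp only [z, w, BinaryForm.coeffHom_mono] at hz hw
  norm_num at hz hw
  apply P1P3.coords_injective
  rw [P1P3.coords_mk, hmk, map_add, P1P3.rep_tmul, P1P3.rep_tmul]
  ext i
  fin_cases i <;> simp [P1P3.coords, -Submodule.coe_add, h0, h1, h2, h3, hz, hw, u, v, z, w]

end Coordinates

/-! ### Stable vectors and limits along one-parameter subgroups -/

section Stability

variable {E : Type*} [Field E] {V : Type*} [AddCommGroup V] [Module E V]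
  {G : Type*} [Group G] (ρ : Representation E G V)

theorem range_rep_rep (g : G) (v : V) :
    (Set.range fun s : G => ρ s (ρ g v)) = Set.range fun s : G => ρ s v := by
  ext w
  constructor
  · rintro ⟨s, rfl⟩
    exact ⟨s * g, by simp⟩
  · rintro ⟨s, rfl⟩
    exact ⟨s * g⁻¹, by simp⟩

theorem finite_stabilizer_rep {v : V} (h : {s : G | ρ s v = v}.Finite) (g : G) :
    {s : G | ρ s (ρ g v) = ρ g v}.Finite := by
  refine (h.image fun s => g * s * g⁻¹).subset fun s hs => ⟨g⁻¹ * s * g, ?_, by group⟩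
  have hs' : ρ s (ρ g v) = ρ g v := hs
  simp [hs']

theorem IsStableVector.rep {v : V} (h : IsStableVector ρ v) (g : G) :
    IsStableVector ρ (ρ g v) :=
  ⟨by rw [range_rep_rep]; exact h.1, finite_stabilizer_rep ρ h.2 g⟩

/-- A polynomial curve in `V` that lies in a Zariski closed set for `t ≠ 0` also does for `t = 0`. -/
theorem IsZariskiClosed.mem_of_curve [Infinite E] {S : Set V} (hS : IsZariskiClosed E S)
    (c : E → V) (hc : ∀ l : Module.Dual E V, ∃ P : Polynomial E, ∀ t, l (c t) = P.eval t)
    (h : ∀ t, t ≠ 0 → c t ∈ S) : c 0 ∈ S := by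
  obtain ⟨T, hT, rfl⟩ := hS
  intro f hf
  have hpoly : ∃ P : Polynomial E, ∀ t, f (c t) = P.eval t := by
    refine Algebra.adjoin_induction
      (p := fun f _ => ∃ P : Polynomial E, ∀ t, f (c t) = P.eval t) ?_ ?_ ?_ ?_ (hT hf)
    · rintro _ ⟨l, rfl⟩
      exact hc l
    · exact fun r => ⟨Polynomial.C r, fun t => by simp⟩
    · rintro f g _ _ ⟨P, hP⟩ ⟨Q, hQ⟩
      exact ⟨P + Q, fun t => by simp [hP, hQ]⟩
    · rintro f g _ _ ⟨P, hP⟩ ⟨Q, hQ⟩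
      exact ⟨P * Q, fun t => by simp [hP, hQ]⟩
  obtain ⟨P, hP⟩ := hpoly
  have hP0 : P = 0 := by
    refine Polynomial.eq_zero_of_infinite_isRoot P
      ((Set.finite_singleton (0 : E)).infinite_compl.mono fun t ht => ?_)
    have : P.eval t = 0 := by rw [← hP]; exact h t ht f hf
    exact this
  rw [hP, hP0, Polynomial.eval_zero]

theorem infinite_units [Infinite E] : Infinite Eˣ :=
  have : Infinite {x : E // x ≠ 0} := (Set.finite_singleton (0 : E)).infinite_compl.to_subtype
  Infinite.of_injective _ (unitsEquivNeZero (G₀ := E)).symm.injective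

/-- The easy half of the Hilbert–Mumford criterion: a vector is not stable if it has a limit `c 0`
under a one-parameter subgroup. For a closed orbit, the limit would lie in the orbit, while its
stabilizer contains the one-parameter subgroup. -/
theorem not_isStableVector_of_limit [Infinite E] (v : V) (c : E → V)
    (hc : ∀ l : Module.Dual E V, ∃ P : Polynomial E, ∀ t, l (c t) = P.eval t)
    (φ : Eˣ → G) (hφ : Function.Injective φ) (h : ∀ t : Eˣ, ρ (φ t) v = c t)
    (h0 : ∀ t : Eˣ, ρ (φ t) (c 0) = c 0) : ¬ IsStableVector ρ v := by
  rintro ⟨hclosed, hfin⟩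
  obtain ⟨g, hg⟩ : c 0 ∈ Set.range fun s : G => ρ s v :=
    hclosed.mem_of_curve c hc fun t ht => ⟨φ (Units.mk0 t ht), by simp [h]⟩
  have hfin' := finite_stabilizer_rep ρ hfin g
  have hg' : ρ g v = c 0 := hg
  rw [hg'] at hfin'
  have := infinite_units (E := E)
  exact Set.infinite_of_injective_forall_mem hφ h0 hfin'

end Stability

/-! ### Elements of `SL₂` -/

section SL2

variable {A : Type*} [CommRing A]

/-- The matrix `(α β; γ δ)` of determinant `1`. -/
def sl2 (α β γ δ : A) (h : α * δ - β * γ = 1) : Matrix.SpecialLinearGroup (Fin 2) A :=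
  ⟨!![α, β; γ, δ], by rw [Matrix.det_fin_two_of, h]⟩

section Entries

variable (α β γ δ : A) (h : α * δ - β * γ = 1)

@[simp] theorem sl2_zero_zero : (sl2 α β γ δ h).1 0 0 = α := rfl
@[simp] theorem sl2_zero_one : (sl2 α β γ δ h).1 0 1 = β := rfl
@[simp] theorem sl2_one_zero : (sl2 α β γ δ h).1 1 0 = γ := rfl
@[simp] theorem sl2_one_one : (sl2 α β γ δ h).1 1 1 = δ := rfl

end Entries

theorem sl2_ext {g g' : Matrix.SpecialLinearGroup (Fin 2) A} (h₁ : g.1 0 0 = g'.1 0 0)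
    (h₂ : g.1 0 1 = g'.1 0 1) (h₃ : g.1 1 0 = g'.1 1 0) (h₄ : g.1 1 1 = g'.1 1 1) : g = g' := by
  apply Subtype.ext
  ext i j
  fin_cases i <;> fin_cases j <;> assumption

theorem sl2_det (g : Matrix.SpecialLinearGroup (Fin 2) A) :
    g.1 0 0 * g.1 1 1 - g.1 0 1 * g.1 1 0 = 1 := by
  rw [← Matrix.det_fin_two, g.2]

/-- A property of elements of `SL₂` over a field that is stable under products and holds for the
elementary matrices holds for all elements. -/
theorem sl2_induction {k : Type*} [Field k] {P : Matrix.SpecialLinearGroup (Fin 2) k → Prop}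
    (upper : ∀ t, P (sl2 1 t 0 1 (by ring))) (lower : ∀ t, P (sl2 1 0 t 1 (by ring)))
    (mul : ∀ g g', P g → P g' → P (g * g')) (g : Matrix.SpecialLinearGroup (Fin 2) k) : P g := by
  have key (g : Matrix.SpecialLinearGroup (Fin 2) k) (hg : g.1 1 0 ≠ 0) : P g := by
    have : g = sl2 1 ((g.1 0 0 - 1) / g.1 1 0) 0 1 (by ring) * sl2 1 0 (g.1 1 0) 1 (by ring)
        * sl2 1 ((g.1 1 1 - 1) / g.1 1 0) 0 1 (by ring) := by
      have hdet := sl2_det g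
      apply sl2_ext <;>
        simp only [Matrix.SpecialLinearGroup.coe_mul, Matrix.mul_apply, Fin.sum_univ_two,
          sl2_zero_zero, sl2_zero_one, sl2_one_zero, sl2_one_one] <;> field_simp <;>
        first | ring1 | linear_combination -hdet
    rw [this]
    exact mul _ _ (mul _ _ (upper _) (lower _)) (upper _)
  by_cases hg : g.1 1 0 = 0
  · have hdet := sl2_det g
    rw [hg, mul_zero, sub_zero] at hdet
    have : g = (g * sl2 1 0 1 1 (by ring)) * sl2 1 0 (-1) 1 (by ring) := by
      apply sl2_ext <;> simp [Matrix.mul_apply, Fin.sum_univ_two]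
    rw [this]
    refine mul _ _ (key _ ?_) (lower _)
    simpa [Matrix.mul_apply, Fin.sum_univ_two, hg] using right_ne_zero_of_mul_eq_one hdet
  · exact key g hg

theorem exists_sl2_row {k : Type*} [Field k] {x y : k} (h : ¬(x = 0 ∧ y = 0)) (i : Fin 2) :
    ∃ g : Matrix.SpecialLinearGroup (Fin 2) k, g.1 i 0 = x ∧ g.1 i 1 = y := by
  refine IsCoprime.exists_SL2_row ?_ i
  by_cases hx : x = 0
  · have hy : y ≠ 0 := fun hy => h ⟨hx, hy⟩
    exact ⟨0, y⁻¹, by simp [hy]⟩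
  · exact ⟨x⁻¹, 0, by simp [hx]⟩

end SL2

/-! ### Invariance -/

section Invariance

variable {k : Type*} [Field k]

/-- The invariant `A2Formula` as a function on `P₁ ⊠ P₃`. -/
def P1P3.A2 (F : P1P3 k) : k :=
  A2Formula (F.coords 0) (F.coords 1) (F.coords 2) (F.coords 3) (F.coords 4) (F.coords 5)
    (F.coords 6) (F.coords 7)

/-- The value of `G₆` at an element of `P₁ ⊠ P₃`. -/
def P1P3.G6 (F : P1P3 k) : k :=
  G6Formula (F.coords 0) (F.coords 1) (F.coords 2) (F.coords 3) (F.coords 4) (F.coords 5)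
    (F.coords 6) (F.coords 7)

/-- The value of `H₆` at an element of `P₁ ⊠ P₃`. -/
def P1P3.H6 (F : P1P3 k) : k :=
  H6Formula (F.coords 0) (F.coords 1) (F.coords 2) (F.coords 3) (F.coords 4) (F.coords 5)
    (F.coords 6) (F.coords 7)

section Values

variable (a b c d e f g h : k)

@[simp] theorem P1P3.A2_mk : (P1P3.mk a b c d e f g h).A2 = A2Formula a b c d e f g h := by
  simp [P1P3.A2]

@[simp] theorem P1P3.G6_mk : (P1P3.mk a b c d e f g h).G6 = G6Formula a b c d e f g h := by
  simp [P1P3.G6]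

@[simp] theorem P1P3.H6_mk : (P1P3.mk a b c d e f g h).H6 = H6Formula a b c d e f g h := by
  simp [P1P3.H6]

end Values

theorem P1P3.H6_eq (F : P1P3 k) : F.H6 = 27 * F.G6 - F.A2 ^ 3 :=
  eq_sub_of_add_eq' (twentySeven_mul_G6Formula _ _ _ _ _ _ _ _).symm

/-- A function on `P₁ ⊠ P₃` is invariant if it does not change under elementary matrices in each
of the two factors. -/
theorem P1P3.invariant_of_elementary (Q : P1P3 k → k)
    (h₁ : ∀ t F, Q (P1P3.rep k (sl2 1 t 0 1 (by ring), 1) F) = Q F)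
    (h₂ : ∀ t F, Q (P1P3.rep k (sl2 1 0 t 1 (by ring), 1) F) = Q F)
    (h₃ : ∀ t F, Q (P1P3.rep k (1, sl2 1 t 0 1 (by ring)) F) = Q F)
    (h₄ : ∀ t F, Q (P1P3.rep k (1, sl2 1 0 t 1 (by ring)) F) = Q F)
    (g : Matrix.SpecialLinearGroup (Fin 2) k × Matrix.SpecialLinearGroup (Fin 2) k) (F : P1P3 k) :
    Q (P1P3.rep k g F) = Q F := by
  have hl : ∀ F, Q (P1P3.rep k (g.1, 1) F) = Q F := by
    refine sl2_induction (P := fun s => ∀ F, Q (P1P3.rep k (s, 1) F) = Q F) h₁ h₂ ?_ g.1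
    intro s s' hs hs' F
    have : ((s * s', 1) : Matrix.SpecialLinearGroup (Fin 2) k × Matrix.SpecialLinearGroup (Fin 2) k)
      = (s, 1) * (s', 1) := by simp
    rw [this, map_mul, Module.End.mul_apply, hs, hs']
  have hr : ∀ F, Q (P1P3.rep k (1, g.2) F) = Q F := by
    refine sl2_induction (P := fun s => ∀ F, Q (P1P3.rep k (1, s) F) = Q F) h₃ h₄ ?_ g.2
    intro s s' hs hs' F
    have : ((1, s * s') : Matrix.SpecialLinearGroup (Fin 2) k × Matrix.SpecialLinearGroup (Fin 2) k)
      = (1, s) * (1, s') := by simp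
    rw [this, map_mul, Module.End.mul_apply, hs, hs']
  have : g = (g.1, 1) * (1, g.2) := by simp
  rw [this, map_mul, Module.End.mul_apply, hl, hr]

theorem P1P3.A2_rep (g : Matrix.SpecialLinearGroup (Fin 2) k × Matrix.SpecialLinearGroup (Fin 2) k)
    (F : P1P3 k) : (P1P3.rep k g F).A2 = F.A2 := by
  refine P1P3.invariant_of_elementary P1P3.A2 ?_ ?_ ?_ ?_ g F <;>
  · intro t F
    obtain ⟨a, b, c, d, e, f, g, h, rfl⟩ := F.exists_eq_mk
    rw [P1P3.rep_mk]
    simp [cubicSubst, A2Formula]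
    try ring

theorem P1P3.G6_rep (g : Matrix.SpecialLinearGroup (Fin 2) k × Matrix.SpecialLinearGroup (Fin 2) k)
    (F : P1P3 k) : (P1P3.rep k g F).G6 = F.G6 := by
  refine P1P3.invariant_of_elementary P1P3.G6 ?_ ?_ ?_ ?_ g F <;>
  · intro t F
    obtain ⟨a, b, c, d, e, f, g, h, rfl⟩ := F.exists_eq_mk
    rw [P1P3.rep_mk]
    simp [cubicSubst, G6Formula]
    ring

theorem P1P3.H6_rep (g : Matrix.SpecialLinearGroup (Fin 2) k × Matrix.SpecialLinearGroup (Fin 2) k)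
    (F : P1P3 k) : (P1P3.rep k g F).H6 = F.H6 := by
  rw [P1P3.H6_eq, P1P3.H6_eq, P1P3.A2_rep, P1P3.G6_rep]

end Invariance

/-! ### Vectors that are not stable -/

section NotStable

variable {k : Type*} [Field k]

theorem P1P3.rep_fst_mk {A : Type*} [CommRing A] (s : Matrix.SpecialLinearGroup (Fin 2) A)
    (a b c d e f g h : A) :
    P1P3.rep A (s, 1) (P1P3.mk a b c d e f g h) =
      P1P3.mk (s.1 0 0 * a + s.1 0 1 * b) (s.1 1 0 * a + s.1 1 1 * b)
        (s.1 0 0 * c + s.1 0 1 * d) (s.1 1 0 * c + s.1 1 1 * d)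
        (s.1 0 0 * e + s.1 0 1 * f) (s.1 1 0 * e + s.1 1 1 * f)
        (s.1 0 0 * g + s.1 0 1 * h) (s.1 1 0 * g + s.1 1 1 * h) := by
  rw [P1P3.rep_mk]
  simp [cubicSubst]

theorem P1P3.rep_snd_mk {A : Type*} [CommRing A] (s : Matrix.SpecialLinearGroup (Fin 2) A)
    (a b c d e f g h : A) :
    let u := cubicSubst (s.1 0 0) (s.1 0 1) (s.1 1 0) (s.1 1 1) a c e g
    let v := cubicSubst (s.1 0 0) (s.1 0 1) (s.1 1 0) (s.1 1 1) b d f h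
    P1P3.rep A (1, s) (P1P3.mk a b c d e f g h) =
      P1P3.mk (u 0) (v 0) (u 1) (v 1) (u 2) (v 2) (u 3) (v 3) := by
  rw [P1P3.rep_mk]
  simp

theorem P1P3.not_stable_of_rep {F : P1P3 k}
    (g : Matrix.SpecialLinearGroup (Fin 2) k × Matrix.SpecialLinearGroup (Fin 2) k)
    (h : ¬IsStableVector (P1P3.rep k) (P1P3.rep k g F)) : ¬IsStableVector (P1P3.rep k) F :=
  fun hF => h (hF.rep _ g)

/-- A curve with monomial coordinates is polynomial. -/
theorem P1P3.exists_polynomial_of_monomials (v : Fin 8 → k) (n : Fin 8 → ℕ)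
    (l : Module.Dual k (P1P3 k)) : ∃ P : Polynomial k, ∀ t,
      l (P1P3.mk (v 0 * t ^ n 0) (v 1 * t ^ n 1) (v 2 * t ^ n 2) (v 3 * t ^ n 3)
        (v 4 * t ^ n 4) (v 5 * t ^ n 5) (v 6 * t ^ n 6) (v 7 * t ^ n 7)) = P.eval t := by
  refine ⟨∑ i, Polynomial.C (v i) * Polynomial.X ^ n i * Polynomial.C (l (P1P3.monomials i)),
    fun t => ?_⟩
  change l (∑ i, (![_, _, _, _, _, _, _, _] : Fin 8 → k) i • P1P3.monomials i) = _
  simp [Fin.sum_univ_eight]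
  ring

/-- A pencil of binary cubics that contains the multiples of `X³` is not stable: it has a limit
under `t ↦ (diag(t³, t⁻³), diag(t, t⁻¹))`. -/
theorem P1P3.not_stable_of_X_cube [Infinite k] (a b c e g : k) :
    ¬IsStableVector (P1P3.rep k) (P1P3.mk a b c 0 e 0 g 0) := by
  refine not_isStableVector_of_limit _ _
    (fun t => P1P3.mk (a * t ^ 6) (b * t ^ 0) (c * t ^ 4) (0 * t ^ 0) (e * t ^ 2) (0 * t ^ 0)
      (g * t ^ 0) (0 * t ^ 0))
    (P1P3.exists_polynomial_of_monomials ![a, b, c, 0, e, 0, g, 0] ![6, 0, 4, 0, 2, 0, 0, 0])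
    (fun t => (sl2 ((t : k) ^ 3) 0 0 ((t⁻¹ : k) ^ 3) (by simp),
      sl2 (t : k) 0 0 (t⁻¹ : k) (by simp)))
    (fun t t' h => Units.ext (congrArg (fun x => x.2.1 0 0) h)) (fun t => ?_) (fun t => ?_)
  all_goals
    have ht : (t : k) ≠ 0 := t.ne_zero
    rw [P1P3.rep_mk]
    simp [cubicSubst]
    congr 1 <;> field_simp

/-- A pencil of binary cubics with a base point, of which one member has a double root there, is
not stable: it has a limit under `t ↦ (diag(t, t⁻¹), diag(t, t⁻¹))`. -/
theorem P1P3.not_stable_of_base_point_X [Infinite k] (a b c d e : k) :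
    ¬IsStableVector (P1P3.rep k) (P1P3.mk a b c d e 0 0 0) := by
  refine not_isStableVector_of_limit _ _
    (fun t => P1P3.mk (a * t ^ 4) (b * t ^ 2) (c * t ^ 2) (d * t ^ 0) (e * t ^ 0) (0 * t ^ 0)
      (0 * t ^ 0) (0 * t ^ 0))
    (P1P3.exists_polynomial_of_monomials ![a, b, c, d, e, 0, 0, 0] ![4, 2, 2, 0, 0, 0, 0, 0])
    (fun t => (sl2 (t : k) 0 0 (t⁻¹ : k) (by simp), sl2 (t : k) 0 0 (t⁻¹ : k) (by simp)))
    (fun t t' h => Units.ext (congrArg (fun x => x.2.1 0 0) h)) (fun t => ?_) (fun t => ?_)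
  all_goals
    have ht : (t : k) ≠ 0 := t.ne_zero
    rw [P1P3.rep_mk]
    simp [cubicSubst]
    congr 1 <;> field_simp

/-- A pencil of binary cubics with a base point `(x : y)` is not stable. -/
theorem P1P3.not_stable_of_base_point [Infinite k] {a b c d e f g h x y : k}
    (hxy : ¬(x = 0 ∧ y = 0)) (h₁ : a * x ^ 3 + c * x ^ 2 * y + e * x * y ^ 2 + g * y ^ 3 = 0)
    (h₂ : b * x ^ 3 + d * x ^ 2 * y + f * x * y ^ 2 + h * y ^ 3 = 0) :
    ¬IsStableVector (P1P3.rep k) (P1P3.mk a b c d e f g h) := by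
  obtain ⟨s, rfl, rfl⟩ := exists_sl2_row hxy 1
  apply P1P3.not_stable_of_rep (1, s)
  rw [P1P3.rep_snd_mk]
  set u := cubicSubst (s.1 0 0) (s.1 0 1) (s.1 1 0) (s.1 1 1) a c e g with hu
  set v := cubicSubst (s.1 0 0) (s.1 0 1) (s.1 1 0) (s.1 1 1) b d f h with hv
  have hu3 : u 3 = 0 := by simpa [hu, cubicSubst] using h₁
  have hv3 : v 3 = 0 := by simpa [hv, cubicSubst] using h₂
  rw [hu3, hv3]
  by_cases h0 : v 2 = 0
  · rw [h0]
    exact P1P3.not_stable_of_base_point_X _ _ _ _ _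
  · obtain ⟨s', h10, h11⟩ := exists_sl2_row (x := v 2) (y := -u 2) (fun h => h0 h.1) 1
    apply P1P3.not_stable_of_rep (s', 1)
    rw [P1P3.rep_fst_mk, h10, h11]
    have : v 2 * u 2 + -u 2 * v 2 = 0 := by ring
    rw [this, mul_zero, mul_zero, add_zero, mul_zero, mul_zero, add_zero]
    exact P1P3.not_stable_of_base_point_X _ _ _ _ _

/-- A pencil of binary cubics in which some member is a multiple of a cube is not stable. -/
theorem P1P3.not_stable_of_cube [Infinite k] {a b c d e f g h z w r u v : k}
    (hzw : ¬(z = 0 ∧ w = 0)) (h₀ : z * a + w * b = r * u ^ 3)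
    (h₁ : z * c + w * d = 3 * r * u ^ 2 * v) (h₂ : z * e + w * f = 3 * r * u * v ^ 2)
    (h₃ : z * g + w * h = r * v ^ 3) :
    ¬IsStableVector (P1P3.rep k) (P1P3.mk a b c d e f g h) := by
  obtain ⟨s, rfl, rfl⟩ := exists_sl2_row hzw 1
  apply P1P3.not_stable_of_rep (s, 1)
  rw [P1P3.rep_fst_mk, h₀, h₁, h₂, h₃]
  by_cases huv : v = 0 ∧ u = 0
  · obtain ⟨rfl, rfl⟩ := huv
    simpa using P1P3.not_stable_of_X_cube _ 0 _ _ _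
  · obtain ⟨s', h10, h11⟩ := exists_sl2_row (x := v) (y := -u)
      (fun h => huv ⟨h.1, neg_eq_zero.1 h.2⟩) 1
    apply P1P3.not_stable_of_rep (1, s')
    rw [P1P3.rep_snd_mk, h10, h11]
    set v' := cubicSubst (s'.1 0 0) (s'.1 0 1) v (-u) (r * u ^ 3) (3 * r * u ^ 2 * v)
      (3 * r * u * v ^ 2) (r * v ^ 3) with hv'
    have hv1 : v' 1 = 0 := by
      simp [hv', cubicSubst]
      ring
    have hv2 : v' 2 = 0 := by
      simp [hv', cubicSubst]
      ring
    have hv3 : v' 3 = 0 := by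
      simp [hv', cubicSubst]
      ring
    simp only [hv1, hv2, hv3]
    exact P1P3.not_stable_of_X_cube _ _ _ _ _

end NotStable

/-! ### Binary forms over an algebraically closed field -/

section Roots

variable {k : Type*} [Field k] [IsAlgClosed k]

theorem exists_root_quadratic {u v w : k} (hu : u ≠ 0) : ∃ t, u * t ^ 2 + v * t + w = 0 := by
  obtain ⟨t, ht⟩ := IsAlgClosed.exists_root
    (Polynomial.C u * Polynomial.X ^ 2 + Polynomial.C v * Polynomial.X + Polynomial.C w)
    (by rw [Polynomial.degree_quadratic hu]; decide)
  exact ⟨t, by simpa using ht⟩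

theorem exists_root_cubic {p q r s : k} (hp : p ≠ 0) :
    ∃ t, p * t ^ 3 + q * t ^ 2 + r * t + s = 0 := by
  obtain ⟨t, ht⟩ := IsAlgClosed.exists_root
    (Polynomial.C p * Polynomial.X ^ 3 + Polynomial.C q * Polynomial.X ^ 2
      + Polynomial.C r * Polynomial.X + Polynomial.C s)
    (by rw [Polynomial.degree_cubic hp]; decide)
  exact ⟨t, by simpa using ht⟩

/-- A binary quadratic form is a product `(y₀X - x₀Y)(y₁X - x₁Y)`. -/
theorem exists_factors_quadratic (u v w : k) : ∃ x₀ y₀ x₁ y₁,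
    u = y₀ * y₁ ∧ v = -(x₀ * y₁ + y₀ * x₁) ∧ w = x₀ * x₁ := by
  by_cases hu : u = 0
  · exact ⟨-1, 0, -w, v, by simp [hu], by ring, by ring⟩
  · obtain ⟨t, ht⟩ := exists_root_quadratic (v := v) (w := w) hu
    exact ⟨t, 1, -(v + u * t), u, by ring, by ring, by linear_combination ht⟩

/-- A binary cubic form is a product `(y₀X - x₀Y)(y₁X - x₁Y)(y₂X - x₂Y)`. -/
theorem exists_factors_cubic (p q r s : k) : ∃ x₀ y₀ x₁ y₁ x₂ y₂,
    p = y₀ * y₁ * y₂ ∧ q = -(x₀ * y₁ * y₂ + y₀ * x₁ * y₂ + y₀ * y₁ * x₂) ∧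
      r = x₀ * x₁ * y₂ + x₀ * y₁ * x₂ + y₀ * x₁ * x₂ ∧ s = -(x₀ * x₁ * x₂) := by
  by_cases hp : p = 0
  · obtain ⟨x₁, y₁, x₂, y₂, h₁, h₂, h₃⟩ := exists_factors_quadratic q r s
    exact ⟨-1, 0, x₁, y₁, x₂, y₂, by simp [hp], by rw [h₁]; ring, by rw [h₂]; ring,
      by rw [h₃]; ring⟩
  · obtain ⟨t, ht⟩ := exists_root_cubic (q := q) (r := r) (s := s) hp
    obtain ⟨x₁, y₁, x₂, y₂, h₁, h₂, h₃⟩ :=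
      exists_factors_quadratic p (q + p * t) (r + (q + p * t) * t)
    exact ⟨t, 1, x₁, y₁, x₂, y₂, by linear_combination h₁, by linear_combination h₂ - t * h₁,
      by linear_combination h₃ - t * h₂, by linear_combination ht - t * h₃⟩

/-- `G₆` is the resultant of the two cubic forms that span the pencil. -/
theorem G6Formula_eq_prod {R : Type*} [CommRing R] (b d f h x₀ y₀ x₁ y₁ x₂ y₂ : R) :
    G6Formula (y₀ * y₁ * y₂) b (-(x₀ * y₁ * y₂ + y₀ * x₁ * y₂ + y₀ * y₁ * x₂)) d
      (x₀ * x₁ * y₂ + x₀ * y₁ * x₂ + y₀ * x₁ * x₂) f (-(x₀ * x₁ * x₂)) h =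
    (b * x₀ ^ 3 + d * x₀ ^ 2 * y₀ + f * x₀ * y₀ ^ 2 + h * y₀ ^ 3)
      * (b * x₁ ^ 3 + d * x₁ ^ 2 * y₁ + f * x₁ * y₁ ^ 2 + h * y₁ ^ 3)
      * (b * x₂ ^ 3 + d * x₂ ^ 2 * y₂ + f * x₂ * y₂ ^ 2 + h * y₂ ^ 3) := by
  simp only [G6Formula]
  ring

theorem exists_zero_cubic (p q r s : k) : ∃ x y, ¬(x = 0 ∧ y = 0) ∧
    p * x ^ 3 + q * x ^ 2 * y + r * x * y ^ 2 + s * y ^ 3 = 0 := by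
  by_cases hp : p = 0
  · exact ⟨1, 0, by simp, by simp [hp]⟩
  · obtain ⟨t, ht⟩ := exists_root_cubic (q := q) (r := r) (s := s) hp
    exact ⟨t, 1, by simp, by linear_combination ht⟩

theorem exists_common_zero {a b c d e f g h : k} (hG : G6Formula a b c d e f g h = 0) :
    ∃ x y, ¬(x = 0 ∧ y = 0) ∧ a * x ^ 3 + c * x ^ 2 * y + e * x * y ^ 2 + g * y ^ 3 = 0 ∧
      b * x ^ 3 + d * x ^ 2 * y + f * x * y ^ 2 + h * y ^ 3 = 0 := by
  obtain ⟨x₀, y₀, x₁, y₁, x₂, y₂, rfl, rfl, rfl, rfl⟩ := exists_factors_cubic a c e g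
  -- A factor `y₀X - x₀Y` with `x₀ = y₀ = 0` makes the first form vanish identically.
  obtain ⟨x, y, hxy, hz⟩ := exists_zero_cubic b d f h
  rw [G6Formula_eq_prod] at hG
  rcases mul_eq_zero.1 hG with hG | hG
  · rcases mul_eq_zero.1 hG with hG | hG
    · by_cases h0 : x₀ = 0 ∧ y₀ = 0
      · exact ⟨x, y, hxy, by simp [h0], hz⟩
      · exact ⟨x₀, y₀, h0, by ring, hG⟩
    · by_cases h0 : x₁ = 0 ∧ y₁ = 0
      · exact ⟨x, y, hxy, by simp [h0], hz⟩
      · exact ⟨x₁, y₁, h0, by ring, hG⟩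
  · by_cases h0 : x₂ = 0 ∧ y₂ = 0
    · exact ⟨x, y, hxy, by simp [h0], hz⟩
    · exact ⟨x₂, y₂, h0, by ring, hG⟩

theorem P1P3.not_stable_of_G6_eq_zero {F : P1P3 k} (hF : F.G6 = 0) :
    ¬IsStableVector (P1P3.rep k) F := by
  have := IsAlgClosed.instInfinite (K := k)
  obtain ⟨a, b, c, d, e, f, g, h, rfl⟩ := F.exists_eq_mk
  rw [P1P3.G6_mk] at hF
  obtain ⟨x, y, hxy, h₁, h₂⟩ := exists_common_zero hF
  exact P1P3.not_stable_of_base_point hxy h₁ h₂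

/-! ### Pencils that contain a cube -/

/-- If `H₆ = 0`, then a substitution `Y ↦ Y - xX` makes the minor `cf - de` vanish. The polynomial
in `x` below is the minor after the substitution. -/
theorem exists_minor_eq_zero {a b c d e f g h : k} (hH : H6Formula a b c d e f g h = 0) :
    ∃ x, 3 * (e * h - f * g) * x ^ 2 + 3 * (d * g - c * h) * x + (c * f - d * e) = 0 := by
  by_cases h3 : (3 : k) = 0
  · -- In characteristic `3`, one has `H₆ = (cf - de)³`.
    refine ⟨0, ?_⟩
    have h27 := twentySeven_mul_G6Formula a b c d e f g h
    have : (c * f - d * e) ^ 3 = 0 := by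
      simp only [A2Formula] at h27
      linear_combination hH + h27 + (-9 * G6Formula a b c d e f g h
        + 3 * (d * e - c * f) ^ 2 * (a * h - b * g) + 9 * (d * e - c * f) * (a * h - b * g) ^ 2
        + 9 * (a * h - b * g) ^ 3) * h3
    simpa using this
  · by_cases hp : e * h - f * g = 0
    · by_cases hq : d * g - c * h = 0
      · refine ⟨0, ?_⟩
        by_contra hr
        have hr' : c * f - d * e ≠ 0 := by simpa using hr
        have hg : g = 0 := by
          refine (mul_eq_zero.1 (?_ : (c * f - d * e) * g = 0)).resolve_left hr'
          linear_combination -c * hp - e * hq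
        have hh : h = 0 := by
          refine (mul_eq_zero.1 (?_ : (c * f - d * e) * h = 0)).resolve_left hr'
          linear_combination -d * hp - f * hq
        subst hg hh
        apply pow_ne_zero 3 hr'
        rw [← hH, H6Formula]
        ring
      · refine ⟨-(c * f - d * e) / (3 * (d * g - c * h)), ?_⟩
        rw [hp]
        field_simp
        ring
    · obtain ⟨x, hx⟩ := exists_root_quadratic (v := 3 * (d * g - c * h)) (w := c * f - d * e)
        (mul_ne_zero h3 hp)
      exact ⟨x, hx⟩

theorem P1P3.not_stable_of_H6_eq_zero_of_reduced {a b c e g h : k}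
    (hH : H6Formula a b c 0 e 0 g h = 0) :
    ¬IsStableVector (P1P3.rep k) (P1P3.mk a b c 0 e 0 g h) := by
  have := IsAlgClosed.instInfinite (K := k)
  by_cases h3 : (3 : k) = 0
  · -- In characteristic `3`, the form `bX³ + hY³` is a cube.
    obtain ⟨u, rfl⟩ := IsAlgClosed.exists_pow_nat_eq b (n := 3) (by norm_num)
    obtain ⟨v, rfl⟩ := IsAlgClosed.exists_pow_nat_eq h (n := 3) (by norm_num)
    exact P1P3.not_stable_of_cube (z := 0) (w := 1) (r := 1) (u := u) (v := v) (by simp)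
      (by ring) (by simp [h3]) (by simp [h3]) (by ring)
  by_cases hb : b = 0
  · exact P1P3.not_stable_of_cube (z := 0) (w := 1) (r := h) (u := 0) (v := 1) (by simp)
      (by simp [hb]) (by simp) (by simp) (by simp)
  by_cases hh : h = 0
  · subst hh
    exact P1P3.not_stable_of_X_cube _ _ _ _ _
  have key : b * e ^ 3 - 3 * b * c * e * g - c ^ 3 * h + 3 * a * c * e * h = 0 := by
    have h27 : (3 : k) ^ 3 * (b * h) ≠ 0 := mul_ne_zero (pow_ne_zero 3 h3) (mul_ne_zero hb hh)
    refine (mul_eq_zero.1 (?_ : 3 ^ 3 * (b * h) * _ = 0)).resolve_left h27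
    rw [← hH, H6Formula]
    ring
  by_cases hc : c = 0
  · have he : e = 0 := by
      rw [hc] at key
      have : b * e ^ 3 = 0 := by linear_combination key
      simpa [hb] using this
    subst hc he
    exact P1P3.not_stable_of_cube (z := h) (w := -g) (r := h * a - g * b) (u := 1) (v := 0)
      (by simp [hh]) (by ring) (by ring) (by ring) (by ring)
  · have he : e ≠ 0 := by
      rintro rfl
      have : c ^ 3 * h = 0 := by linear_combination -key
      simp [hc, hh] at this
    -- The cube has to be proportional to `(cX + eY)³`, by the coefficients of `X²Y` and `XY²`.
    refine P1P3.not_stable_of_cube (z := 1) (w := (c ^ 2 / (3 * e) - a) / b)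
      (r := 1 / (3 * c * e)) (u := c) (v := e) (by simp) ?_ ?_ ?_ ?_
    · field_simp
      ring
    · field_simp
      ring
    · field_simp
      ring
    · field_simp
      linear_combination -key

theorem P1P3.not_stable_of_H6_eq_zero {F : P1P3 k} (hF : F.H6 = 0) :
    ¬IsStableVector (P1P3.rep k) F := by
  obtain ⟨a, b, c, d, e, f, g, h, rfl⟩ := F.exists_eq_mk
  obtain ⟨x, hx⟩ := exists_minor_eq_zero (by rwa [P1P3.H6_mk] at hF)
  apply P1P3.not_stable_of_rep (1, sl2 1 (-x) 0 1 (by ring))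
  rw [← P1P3.H6_rep (1, sl2 1 (-x) 0 1 (by ring))] at hF
  rw [P1P3.rep_snd_mk] at hF ⊢
  set u := cubicSubst ((sl2 1 (-x) 0 1 (by ring)).1 0 0) _ _ _ a c e g with hu
  set v := cubicSubst ((sl2 1 (-x) 0 1 (by ring)).1 0 0) _ _ _ b d f h with hv
  have hminor : u 1 * v 2 - v 1 * u 2 = 0 := by
    simp [hu, hv, cubicSubst]
    linear_combination hx
  clear_value u v
  obtain ⟨z, w, hzw, h₁, h₂⟩ : ∃ z w, ¬(z = 0 ∧ w = 0) ∧ z * u 1 + w * v 1 = 0 ∧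
      z * u 2 + w * v 2 = 0 := by
    by_cases h₁ : u 1 = 0 ∧ v 1 = 0
    · by_cases h₂ : u 2 = 0 ∧ v 2 = 0
      · exact ⟨0, 1, by simp, by simp [h₁], by simp [h₂]⟩
      · exact ⟨-v 2, u 2, fun h => h₂ ⟨h.2, neg_eq_zero.1 h.1⟩, by simp [h₁], by ring⟩
    · exact ⟨-v 1, u 1, fun h => h₁ ⟨h.2, neg_eq_zero.1 h.1⟩, by ring,
        by linear_combination hminor⟩
  obtain ⟨s, rfl, rfl⟩ := exists_sl2_row hzw 1
  apply P1P3.not_stable_of_rep (s, 1)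
  rw [← P1P3.H6_rep (s, 1)] at hF
  rw [P1P3.rep_fst_mk, h₁, h₂] at hF ⊢
  rw [P1P3.H6_mk] at hF
  exact P1P3.not_stable_of_H6_eq_zero_of_reduced hF

end Roots

/-! ### The normal form of a pencil with `G₆ ≠ 0` and `H₆ ≠ 0` -/

section NormalForm

variable {k : Type*} [Field k] [IsAlgClosed k]

theorem exists_zero_quartic (p q r s t : k) : ∃ z w, ¬(z = 0 ∧ w = 0) ∧
    p * (z ^ 4 * w ^ 0) + q * (z ^ 3 * w ^ 1) + r * (z ^ 2 * w ^ 2) + s * (z ^ 1 * w ^ 3)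
      + t * (z ^ 0 * w ^ 4) = 0 := by
  by_cases hp : p = 0
  · exact ⟨1, 0, by simp, by simp [hp]⟩
  · let P : Polynomial k := Polynomial.C p * Polynomial.X ^ 4 + Polynomial.C q * Polynomial.X ^ 3
      + Polynomial.C r * Polynomial.X ^ 2 + Polynomial.C s * Polynomial.X + Polynomial.C t
    have hP : P.degree = 4 := by
      simp only [P]
      compute_degree!
    obtain ⟨z, hz⟩ := IsAlgClosed.exists_root P (by rw [hP]; decide)
    have hz' : p * z ^ 4 + q * z ^ 3 + r * z ^ 2 + s * z + t = 0 := by simpa [P] using hz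
    exact ⟨z, 1, by simp, by linear_combination hz'⟩

theorem cubicFormDisc_eq_prod {R : Type*} [CommRing R] (x₀ y₀ x₁ y₁ x₂ y₂ : R) :
    cubicFormDisc (y₀ * y₁ * y₂) (-(x₀ * y₁ * y₂ + y₀ * x₁ * y₂ + y₀ * y₁ * x₂))
      (x₀ * x₁ * y₂ + x₀ * y₁ * x₂ + y₀ * x₁ * x₂) (-(x₀ * x₁ * x₂)) =
    ((x₀ * y₁ - x₁ * y₀) * (x₀ * y₂ - x₂ * y₀) * (x₁ * y₂ - x₂ * y₁)) ^ 2 := by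
  simp only [cubicFormDisc]
  ring

/-- A binary cubic form of discriminant zero has a double zero. In small characteristic the
vanishing of the partial derivatives does not imply that of the form. -/
theorem exists_double_zero {p q r s : k} (h : cubicFormDisc p q r s = 0) :
    ∃ x y, ¬(x = 0 ∧ y = 0) ∧ p * x ^ 3 + q * x ^ 2 * y + r * x * y ^ 2 + s * y ^ 3 = 0 ∧
      3 * p * x ^ 2 + 2 * q * x * y + r * y ^ 2 = 0 ∧
      q * x ^ 2 + 2 * r * x * y + 3 * s * y ^ 2 = 0 := by
  obtain ⟨x₀, y₀, x₁, y₁, x₂, y₂, rfl, rfl, rfl, rfl⟩ := exists_factors_cubic p q r s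
  rw [cubicFormDisc_eq_prod] at h
  -- A factor `y₀X - x₀Y` with `x₀ = y₀ = 0` makes the form vanish identically.
  rcases mul_eq_zero.1 (pow_eq_zero_iff two_ne_zero |>.1 h) with h | h
  · rcases mul_eq_zero.1 h with h | h
    · by_cases h0 : x₀ = 0 ∧ y₀ = 0
      · exact ⟨1, 0, by simp, by simp [h0], by simp [h0], by simp [h0]⟩
      · exact ⟨x₀, y₀, h0, by ring, by linear_combination y₀ * (y₂ * x₀ - x₂ * y₀) * h,
          by linear_combination -x₀ * (y₂ * x₀ - x₂ * y₀) * h⟩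
    · by_cases h0 : x₀ = 0 ∧ y₀ = 0
      · exact ⟨1, 0, by simp, by simp [h0], by simp [h0], by simp [h0]⟩
      · exact ⟨x₀, y₀, h0, by ring, by linear_combination y₀ * (y₁ * x₀ - x₁ * y₀) * h,
          by linear_combination -x₀ * (y₁ * x₀ - x₁ * y₀) * h⟩
  · by_cases h0 : x₁ = 0 ∧ y₁ = 0
    · exact ⟨1, 0, by simp, by simp [h0], by simp [h0], by simp [h0]⟩
    · exact ⟨x₁, y₁, h0, by ring, by linear_combination y₁ * (y₀ * x₁ - x₀ * y₁) * h,
        by linear_combination -x₁ * (y₀ * x₁ - x₀ * y₁) * h⟩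

/-- Every pencil of binary cubics has a member with a double zero, because `disc_{X,Y} F` has a
zero. The double zero is moved to `X = 0`. -/
theorem P1P3.exists_rep_double_zero (F : P1P3 k) :
    ∃ g a b c d f h, P1P3.rep k g F = P1P3.mk a b c d 0 f 0 h := by
  obtain ⟨a, b, c, d, e, f, g, h, rfl⟩ := F.exists_eq_mk
  obtain ⟨z, w, hzw, hdisc⟩ := exists_zero_quartic (cubicFormDisc a c e g)
    (discCoeff₃₁ a b c d e f g h) (discCoeff₂₂ a b c d e f g h) (discCoeff₃₁ b a d c f e h g)
    (cubicFormDisc b d f h)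
  rw [← cubicFormDisc_pencil] at hdisc
  obtain ⟨x, y, hxy, h₀, h₁, h₂⟩ := exists_double_zero hdisc
  obtain ⟨s, rfl, rfl⟩ := exists_sl2_row hzw 0
  obtain ⟨s', rfl, rfl⟩ := exists_sl2_row hxy 1
  have hg : ((s, s') : Matrix.SpecialLinearGroup (Fin 2) k × Matrix.SpecialLinearGroup (Fin 2) k)
    = (1, s') * (s, 1) := by simp
  refine ⟨(s, s'), ?_⟩
  rw [hg, map_mul, Module.End.mul_apply, P1P3.rep_fst_mk, P1P3.rep_snd_mk]
  refine ⟨_, _, _, _, _, _, P1P3.mk_inj.2 ⟨rfl, rfl, rfl, rfl, ?_, rfl, ?_, rfl⟩⟩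
  · simp only [cubicSubst, Matrix.cons_val]
    linear_combination s'.1 0 0 * h₁ + s'.1 0 1 * h₂
  · simp only [cubicSubst, Matrix.cons_val]
    linear_combination h₀

/-- Over an algebraically closed field, an element with `G₆ ≠ 0` and `H₆ ≠ 0` can be brought into
the form `Z ⊗ X²Y + W ⊗ (bX³ + fXY² + Y³)`. The invariants determine `b` and `f`. -/
theorem P1P3.exists_rep_eq_normalForm {F : P1P3 k} (hG : F.G6 ≠ 0) (hH : F.H6 ≠ 0) :
    ∃ g, P1P3.rep k g F = P1P3.mk 0 (-F.G6) 1 0 0 (-F.A2) 0 1 := by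
  obtain ⟨g₁, a, b, c, d, f, h, e₁⟩ := F.exists_rep_double_zero
  have hc : c ≠ 0 := by
    rintro rfl
    apply hH
    rw [← P1P3.H6_rep g₁, e₁, P1P3.H6_mk, H6Formula]
    ring
  obtain ⟨g₂, b, d, f, h, e₂⟩ : ∃ g b d f h, P1P3.rep k g F = P1P3.mk 0 b c d 0 f 0 h := by
    refine ⟨(1, sl2 1 (-a / c) 0 1 (by ring)) * g₁, ?_⟩
    rw [map_mul, Module.End.mul_apply, e₁, P1P3.rep_snd_mk]
    simp only [cubicSubst, Matrix.cons_val, sl2_zero_zero, sl2_zero_one, sl2_one_zero, sl2_one_one]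
    refine ⟨_, _, _, _, P1P3.mk_inj.2 ⟨?_, rfl, ?_, rfl, ?_, rfl, ?_, rfl⟩⟩
    · field_simp
      ring
    all_goals ring
  obtain ⟨g₃, e₃⟩ : ∃ g, P1P3.rep k g F = P1P3.mk 0 b c 0 0 f 0 h := by
    refine ⟨(sl2 1 0 (-d / c) 1 (by ring), 1) * g₂, ?_⟩
    rw [map_mul, Module.End.mul_apply, e₂, P1P3.rep_fst_mk]
    simp only [sl2_zero_zero, sl2_zero_one, sl2_one_zero, sl2_one_one]
    congr 1 <;> field_simp <;> ring
  have hh : h ≠ 0 := by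
    rintro rfl
    apply hG
    rw [← P1P3.G6_rep g₃, e₃, P1P3.G6_mk, G6Formula]
    ring
  obtain ⟨t, ht⟩ := IsAlgClosed.exists_pow_nat_eq (c * h) (n := 2) (by norm_num)
  have ht0 : t ≠ 0 := by
    rintro rfl
    simp [hc, hh] at ht
  obtain ⟨g₄, b, f, e₄⟩ : ∃ g b f, P1P3.rep k g F = P1P3.mk 0 b 1 0 0 f 0 1 := by
    -- The weights of the torus on `X²Y` and `Y³` are chosen to make both coefficients `1`.
    refine ⟨(sl2 (t * c)⁻¹ 0 0 (t * c) (by field_simp; ring), sl2 t 0 0 t⁻¹ (by field_simp; ring))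
      * g₃, ?_⟩
    rw [map_mul, Module.End.mul_apply, e₃, P1P3.rep_mk]
    simp only [cubicSubst, Matrix.cons_val, sl2_zero_zero, sl2_zero_one, sl2_one_zero, sl2_one_one]
    refine ⟨_, _, P1P3.mk_inj.2 ⟨?_, rfl, ?_, ?_, ?_, rfl, ?_, ?_⟩⟩
    · ring
    · field_simp
      ring
    · ring
    · ring
    · ring
    · field_simp
      linear_combination -t * ht
  refine ⟨g₄, ?_⟩
  have hb : F.G6 = -b := by
    rw [← P1P3.G6_rep g₄, e₄, P1P3.G6_mk, G6Formula]
    ring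
  have hf : F.A2 = -f := by
    rw [← P1P3.A2_rep g₄, e₄, P1P3.A2_mk, A2Formula]
    ring
  rw [e₄, hb, hf, neg_neg, neg_neg]

/-- The orbit of an element with `G₆ ≠ 0` and `H₆ ≠ 0` is a level set of the invariants. -/
theorem P1P3.orbit_eq {F : P1P3 k} (hG : F.G6 ≠ 0) (hH : F.H6 ≠ 0) :
    (Set.range fun g => P1P3.rep k g F) = {F' | F'.A2 = F.A2 ∧ F'.G6 = F.G6} := by
  ext F'
  constructor
  · rintro ⟨g, rfl⟩
    exact ⟨P1P3.A2_rep g F, P1P3.G6_rep g F⟩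
  · rintro ⟨hA', hG'⟩
    obtain ⟨g, hg⟩ := P1P3.exists_rep_eq_normalForm hG hH
    obtain ⟨g', hg'⟩ := P1P3.exists_rep_eq_normalForm (F := F') (by rwa [hG'])
      (by rwa [P1P3.H6_eq, hA', hG', ← P1P3.H6_eq])
    rw [hA', hG', ← hg] at hg'
    refine ⟨g'⁻¹ * g, ?_⟩
    simp only [map_mul, Module.End.mul_apply]
    rw [← hg']
    simp

end NormalForm

section Closed

variable {k : Type*} [Field k]

theorem P1P3.eval_coords_mem (Q : MvPolynomial (Fin 8) k) :
    (fun F : P1P3 k => eval F.coords Q) ∈ polynomialFunctionAlgebra k (P1P3 k) := by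
  induction Q using MvPolynomial.induction_on with
  | C r =>
    simp only [eval_C]
    exact (polynomialFunctionAlgebra k (P1P3 k)).algebraMap_mem r
  | add P Q hP hQ =>
    simp only [map_add]
    exact Subalgebra.add_mem _ hP hQ
  | mul_X P i hP =>
    simp only [map_mul, eval_X]
    exact Subalgebra.mul_mem _ hP (Algebra.subset_adjoin
      ⟨(LinearMap.proj i).comp (P1P3.coordsEquiv k).toLinearMap, rfl⟩)

theorem P1P3.isZariskiClosed_level (x y : k) :
    IsZariskiClosed k {F : P1P3 k | F.A2 = x ∧ F.G6 = y} := by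
  let Q : MvPolynomial (Fin 8) k :=
    A2Formula (X 0) (X 1) (X 2) (X 3) (X 4) (X 5) (X 6) (X 7) - C x
  let R : MvPolynomial (Fin 8) k :=
    G6Formula (X 0) (X 1) (X 2) (X 3) (X 4) (X 5) (X 6) (X 7) - C y
  have hQ (F : P1P3 k) : eval F.coords Q = F.A2 - x := by
    simp [Q, P1P3.A2, A2Formula]
  have hR (F : P1P3 k) : eval F.coords R = F.G6 - y := by
    simp [R, P1P3.G6, G6Formula]
  refine ⟨{fun F => eval F.coords Q, fun F => eval F.coords R}, ?_, ?_⟩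
  · rintro _ (rfl | rfl)
    · exact P1P3.eval_coords_mem Q
    · exact P1P3.eval_coords_mem R
  · ext F
    simp [hQ, hR, sub_eq_zero]

end Closed

/-! ### Finiteness of the stabilizer -/

section Stabilizer

variable {k : Type*} [Field k]

/-- An element of the stabilizer of `Z ⊗ X²Y + W ⊗ (bX³ + fXY² + Y³)` maps `X²Y` to a combination
of `X²Y` and `bX³ + fXY² + Y³`. -/
theorem P1P3.stabilizer_normalForm {b f : k}
    {g : Matrix.SpecialLinearGroup (Fin 2) k × Matrix.SpecialLinearGroup (Fin 2) k}
    (hg : P1P3.rep k g (P1P3.mk 0 b 1 0 0 f 0 1) = P1P3.mk 0 b 1 0 0 f 0 1) :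
    g.2.1 0 0 ^ 2 * g.2.1 0 1 = -g.1.1 0 1 * b ∧
      g.2.1 0 0 ^ 2 * g.2.1 1 1 + 2 * g.2.1 0 0 * g.2.1 0 1 * g.2.1 1 0 = g.1.1 1 1 ∧
      g.2.1 1 0 ^ 2 * g.2.1 0 1 + 2 * g.2.1 0 0 * g.2.1 1 0 * g.2.1 1 1 = -g.1.1 0 1 * f ∧
      g.2.1 1 0 ^ 2 * g.2.1 1 1 = -g.1.1 0 1 := by
  have hdet := sl2_det g.1
  rw [P1P3.rep_mk] at hg
  obtain ⟨h0, h1, h2, h3, h4, h5, h6, h7⟩ := P1P3.mk_inj.1 hg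
  simp only [cubicSubst, Matrix.cons_val] at h0 h1 h2 h3 h4 h5 h6 h7
  refine ⟨?_, ?_, ?_, ?_⟩
  · linear_combination g.1.1 1 1 * h0 - g.1.1 0 1 * h1
      - (g.2.1 0 0 ^ 2 * g.2.1 0 1) * hdet
  · linear_combination g.1.1 1 1 * h2 - g.1.1 0 1 * h3
      - (g.2.1 0 0 ^ 2 * g.2.1 1 1 + 2 * g.2.1 0 0 * g.2.1 0 1 * g.2.1 1 0) * hdet
  · linear_combination g.1.1 1 1 * h4 - g.1.1 0 1 * h5
      - (g.2.1 1 0 ^ 2 * g.2.1 0 1 + 2 * g.2.1 0 0 * g.2.1 1 0 * g.2.1 1 1) * hdet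
  · linear_combination g.1.1 1 1 * h6 - g.1.1 0 1 * h7
      - (g.2.1 1 0 ^ 2 * g.2.1 1 1) * hdet

/-- The elements of the stabilizer that fix the double zero of `X²Y` are diagonal. -/
theorem P1P3.finite_stabilizer_triangular (b f : k) :
    {g : Matrix.SpecialLinearGroup (Fin 2) k × Matrix.SpecialLinearGroup (Fin 2) k |
      P1P3.rep k g (P1P3.mk 0 b 1 0 0 f 0 1) = P1P3.mk 0 b 1 0 0 f 0 1 ∧ g.2.1 1 0 = 0}.Finite := by
  have key : ∀ g : Matrix.SpecialLinearGroup (Fin 2) k × Matrix.SpecialLinearGroup (Fin 2) k,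
      P1P3.rep k g (P1P3.mk 0 b 1 0 0 f 0 1) = P1P3.mk 0 b 1 0 0 f 0 1 → g.2.1 1 0 = 0 →
      g.2.1 0 0 ^ 2 = 1 ∧ g.2.1 0 1 = 0 ∧ g.2.1 1 1 = g.2.1 0 0 ∧ g.1.1 0 0 = g.2.1 0 0 ∧
        g.1.1 0 1 = 0 ∧ g.1.1 1 0 = 0 ∧ g.1.1 1 1 = g.2.1 0 0 := by
    intro g hg h10
    obtain ⟨k0, k1, -, k3⟩ := P1P3.stabilizer_normalForm hg
    have hdet₁ := sl2_det g.1
    have hdet₂ := sl2_det g.2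
    rw [P1P3.rep_mk] at hg
    obtain ⟨-, -, h2, h3, -, -, -, h7⟩ := P1P3.mk_inj.1 hg
    simp only [cubicSubst, Matrix.cons_val] at h2 h3 h7
    rw [h10] at hdet₂ k1 k3 h2 h3 h7
    have hy : g.1.1 0 1 = 0 := by linear_combination k3
    have hα : g.2.1 0 0 ≠ 0 := fun h => by simp [h] at hdet₂
    have hβ : g.2.1 0 1 = 0 := by simpa [hy, hα] using k0
    rw [hy] at hdet₁ h2
    rw [hβ] at hdet₂ k1 h2 h3
    have hw : g.1.1 1 1 = g.2.1 0 0 := by linear_combination -k1 + g.2.1 0 0 * hdet₂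
    have hz : g.1.1 1 0 = 0 := by
      refine (mul_eq_zero.1 (?_ : g.1.1 1 0 * g.2.1 0 0 = 0)).resolve_right hα
      linear_combination h3 - g.1.1 1 0 * g.2.1 0 0 * hdet₂
    rw [hw] at hdet₁ h7
    have hδ2 : g.2.1 1 1 ^ 2 = 1 := by linear_combination h7 - g.2.1 1 1 ^ 2 * hdet₂
    have hδ : g.2.1 1 1 = g.2.1 0 0 := by
      linear_combination g.2.1 0 0 * hδ2 - g.2.1 1 1 * hdet₂
    have hα2 : g.2.1 0 0 ^ 2 = 1 := by rw [← hδ, hδ2]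
    refine ⟨hα2, hβ, hδ, ?_, hy, hz, hw⟩
    linear_combination g.2.1 0 0 * hdet₁ - g.1.1 0 0 * hα2
  refine Set.Finite.of_injOn (f := fun g => g.2.1 0 0) (t := {1, -1}) ?_ ?_ (by simp)
  · rintro g ⟨hg, h10⟩
    exact (mul_eq_zero.1 (show (g.2.1 0 0 - 1) * (g.2.1 0 0 + 1) = 0 by
      linear_combination (key g hg h10).1)).imp sub_eq_zero.1 eq_neg_of_add_eq_zero_left
  · rintro g ⟨hg, h10⟩ g' ⟨hg', h10'⟩ h
    obtain ⟨-, p1, p2, p3, p4, p5, p6⟩ := key g hg h10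
    obtain ⟨-, q1, q2, q3, q4, q5, q6⟩ := key g' hg' h10'
    have h' : g.2.1 0 0 = g'.2.1 0 0 := h
    exact Prod.ext (sl2_ext (by rw [p3, q3, h']) (by rw [p4, q4]) (by rw [p5, q5])
      (by rw [p6, q6, h'])) (sl2_ext h' (by rw [p1, q1]) (by rw [h10, h10']) (by rw [p2, q2, h']))

/-- An element of the stabilizer with second component `(α β; γ δ)` maps `X²Y` to a member of the
pencil with a double zero at `αX + γY = 0`. Unless `γ = 0`, the ratio `α / γ` is a root of an
explicit cubic polynomial, and elements with the same ratio differ by one that fixes `X = 0`. -/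
theorem P1P3.finite_stabilizer_normalForm {b : k} (hb : b ≠ 0) (f : k) :
    {g : Matrix.SpecialLinearGroup (Fin 2) k × Matrix.SpecialLinearGroup (Fin 2) k |
      P1P3.rep k g (P1P3.mk 0 b 1 0 0 f 0 1) = P1P3.mk 0 b 1 0 0 f 0 1}.Finite := by
  let P : Polynomial k := Polynomial.C 2 * Polynomial.X ^ 3 - Polynomial.C f * Polynomial.X ^ 2
    + Polynomial.C b
  have hP : P ≠ 0 := by
    intro h
    apply hb
    simpa [P] using congrArg (Polynomial.eval 0) h
  have hK := P1P3.finite_stabilizer_triangular b f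
  set N := P1P3.mk 0 b 1 0 0 f 0 1 with hN
  refine (hK.union (Set.Finite.biUnion (Polynomial.finite_setOfPred_isRoot hP)
    (t := fun r => {g | P1P3.rep k g N = N ∧ g.2.1 1 0 ≠ 0 ∧ g.2.1 0 0 = r * g.2.1 1 0}) ?_)).subset
    fun g hg => ?_
  · intro r _
    rcases Set.eq_empty_or_nonempty
      {g | P1P3.rep k g N = N ∧ g.2.1 1 0 ≠ 0 ∧ g.2.1 0 0 = r * g.2.1 1 0} with h | ⟨g₀, h1, -, h3⟩
    · rw [h]
      exact Set.finite_empty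
    · refine (hK.image fun g => g₀ * g).subset ?_
      rintro g ⟨h1', -, h3'⟩
      refine ⟨g₀⁻¹ * g, ⟨?_, ?_⟩, by simp⟩
      · rw [map_mul, Module.End.mul_apply, h1']
        conv_lhs => rw [← h1]
        simp
      · change (g₀.2⁻¹ * g.2).1 1 0 = 0
        rw [Matrix.SpecialLinearGroup.coe_mul, Matrix.mul_apply, Fin.sum_univ_two,
          Matrix.SpecialLinearGroup.SL2_inv_expl]
        simp [h3, h3']
        ring
  · by_cases h10 : g.2.1 1 0 = 0
    · exact Or.inl ⟨hg, h10⟩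
    · refine Or.inr (Set.mem_biUnion (x := g.2.1 0 0 / g.2.1 1 0) ?_ ⟨hg, h10, by field_simp⟩)
      obtain ⟨k0, -, k2, k3⟩ := P1P3.stabilizer_normalForm hg
      have hdet := sl2_det g.2
      generalize g.2.1 0 0 = α at *
      generalize g.2.1 0 1 = β at *
      generalize g.2.1 1 0 = γ at *
      generalize g.2.1 1 1 = δ at *
      have e1 : γ * β + 2 * α * δ = f * γ * δ := by
        apply mul_left_cancel₀ h10
        linear_combination k2 - f * k3
      have e2 : 3 * α * δ - f * γ * δ = 1 := by linear_combination e1 + hdet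
      have hδ : δ ≠ 0 := by
        rintro rfl
        simp at e2
      have e3 : 2 * α ^ 3 - f * α ^ 2 * γ + b * γ ^ 3 = 0 := by
        refine (mul_eq_zero.1 (?_ : δ * _ = 0)).resolve_left hδ
        linear_combination α ^ 2 * e2 - γ * k0 + b * γ * k3 - α ^ 2 * hdet
      have : P.eval (α / γ) = 0 := by
        simp [P]
        field_simp
        linear_combination e3
      exact this

end Stabilizer

/-! ### Stability and the discriminant -/

theorem P1P3.isStableVector_iff {k : Type*} [Field k] [IsAlgClosed k] (F : P1P3 k) :
    IsStableVector (P1P3.rep k) F ↔ F.H6 ≠ 0 ∧ F.G6 ≠ 0 := by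
  constructor
  · exact fun h => ⟨fun hH => P1P3.not_stable_of_H6_eq_zero hH h,
      fun hG => P1P3.not_stable_of_G6_eq_zero hG h⟩
  · rintro ⟨hH, hG⟩
    refine ⟨?_, ?_⟩
    · rw [P1P3.orbit_eq hG hH]
      exact P1P3.isZariskiClosed_level _ _
    · obtain ⟨g, hg⟩ := P1P3.exists_rep_eq_normalForm hG hH
      have hfin := P1P3.finite_stabilizer_normalForm (neg_ne_zero.2 hG) (-F.A2)
      have hF : F = P1P3.rep k g⁻¹ (P1P3.mk 0 (-F.G6) 1 0 0 (-F.A2) 0 1) := by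
        rw [← hg]
        simp
      have hfin' := finite_stabilizer_rep (P1P3.rep k)
        (v := P1P3.mk 0 (-F.G6) 1 0 0 (-F.A2) 0 1) hfin g⁻¹
      rwa [← hF] at hfin'

end

theorem proposition5p2 :
    (∀ (A : Type*) [CommRing A] (F : P1P3 A),
      discZW (P1P3.discXY F) = -(2 ^ 8) * MvPolynomial.aeval (P1P3.coords F) Delta) ∧
    ∀ (p : ℕ) [Fact p.Prime] (F : P1P3 (AlgebraicClosure (ZMod p))),
      IsStableVector (P1P3.rep (AlgebraicClosure (ZMod p))) F ↔
        MvPolynomial.eval (P1P3.coords F) (DeltaBar p) ≠ 0 := by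
  refine ⟨fun A _ F => P1P3.discZW_discXY F, fun p _ F => ?_⟩
  have h : eval (P1P3.coords F) (DeltaBar p) = F.H6 ^ 3 * F.G6 := by
    rw [DeltaBar, eval_map, ← algebraMap_int_eq, ← aeval_def, aeval_Delta]
    rfl
  rw [h, P1P3.isStableVector_iff, mul_ne_zero_iff, pow_ne_zero_iff three_ne_zero]
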